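/- For a Borel set $E\subset\mathbb R$ let $\gamma(E)=\frac1{\sqrt{2\pi}}\int_E e^{-x^2/2}\,dx$ and $b(E)=\int_E x\,d\gamma(x)$, and let $\phi(s)=\gamma((-\infty,s))$. Let $a(s)>0$ be the number with $\gamma((-a(s),a(s)))=\phi(s)$. If $E$ has locally finite perimeter, with reduced boundary $\partial^*E$, let $P_\gamma(E)=\int_{\partial^*E}e^{-x^2/2}\,d\mathcal H^0(x)$. For $s>0$ and $\varepsilon>0$ define, for every set $E\subset\mathbb R$ of locally finite perimeter, $$\mathcal F(E)=P_\gamma(E)+\varepsilon\sqrt{\pi/2}\,|b(E)|^2+(s+1)\sqrt{2\pi}\,\bigl|\gamma(E)-\phi(s)\bigr|.$$ Theorem. There is $s_0>0$ such that for all $s\ge s_0$ and all $\varepsilon$ with $$\frac65\,\frac{\sqrt{2\pi}}{s^2}\,e^{s^2/2}\le\varepsilon\le\frac75\,\frac{\sqrt{2\pi}}{s^2}\,e^{s^2/2}$$ the functional $\mathcal F$ has a minimizer among all sets of locally finite perimeter in $\mathbb R$, and every minimizer coincides, up to a set of Lebesgue measure zero, with one of $(-\infty,s)$, $(-s,\infty)$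 and $(-a(s),a(s))$. -/

import Mathlib

open MeasureTheory ProbabilityTheory Filter Topology Set
open scoped ENNReal

noncomputable section

/-- The standard Gaussian measure `γ` on `ℝ`, with density `(2π)^(-1/2) exp (-x² / 2)`. -/
abbrev gaussLine : Measure ℝ := gaussianReal 0 1

/-- `φ(s) = (2π)^(-1/2) ∫_{-∞}^s exp (-t² / 2) dt`. -/
def gaussPhi (s : ℝ) : ℝ :=
  (√(2 * Real.pi))⁻¹ * ∫ t in Iio s, Real.exp (-t ^ 2 / 2)

/-- The (non-renormalized) barycenter `b(E) = ∫_E x dγ(x)`. -/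
def gaussBarycenter (E : Set ℝ) : ℝ := ∫ x in E, x ∂gaussLine

theorem gaussPhi_eq (s : ℝ) : gaussPhi s = gaussLine.real (Iio s) := by
  rw [gaussPhi, gaussLine, measureReal_def, gaussianReal_apply_eq_integral 0 one_ne_zero,
    ENNReal.toReal_ofReal (integral_nonneg fun x => gaussianPDFReal_nonneg 0 1 x),
    ← integral_const_mul]
  simp [gaussianPDFReal]

theorem gaussLine_real_Ioo (a : ℝ) (ha : 0 ≤ a) :
    gaussLine.real (Ioo (-a) a) = ∫ t in (-a)..a, gaussianPDFReal 0 1 t := by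
  rw [gaussLine, measureReal_def, gaussianReal_apply_eq_integral 0 one_ne_zero,
    ENNReal.toReal_ofReal (integral_nonneg fun x => gaussianPDFReal_nonneg 0 1 x),
    intervalIntegral.integral_of_le (by linarith), integral_Ioc_eq_integral_Ioo]

theorem gaussLine_pos_of_Ioo_subset {u v : ℝ} (h : u < v) {S : Set ℝ} (hS : Ioo u v ⊆ S) :
    0 < gaussLine.real S := by
  have h1 : gaussLine (Ioo u v) ≠ 0 := by
    intro h0
    have h2 := gaussianReal_absolutelyContinuous' 0 (v := 1) one_ne_zero h0
    simp [Real.volume_Ioo] at h2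
    linarith
  have h3 : gaussLine S ≠ 0 := fun h0 => h1 (measure_mono_null hS h0)
  exact ENNReal.toReal_pos h3 (measure_ne_top _ _)

/-- For every `s` there is exactly one `a > 0` for which the half-line `(-∞, s)` and the
symmetric interval `(-a, a)` have the same Gaussian measure. -/
theorem existsUnique_stripRadius (s : ℝ) :
    ∃! a : ℝ, 0 < a ∧ gaussLine.real (Ioo (-a) a) = gaussLine.real (Iio s) := by
  have hint : Integrable (gaussianPDFReal 0 1) := integrable_gaussianPDFReal 0 1
  have hpos : 0 < gaussLine.real (Iio s) :=
    gaussLine_pos_of_Ioo_subset (sub_one_lt s) fun x hx => hx.2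
  have hlt : gaussLine.real (Iio s) < 1 := by
    have h1 : gaussLine.real (Iio s)ᶜ = 1 - gaussLine.real (Iio s) :=
      probReal_compl_eq_one_sub measurableSet_Iio
    have h2 : 0 < gaussLine.real (Iio s)ᶜ :=
      gaussLine_pos_of_Ioo_subset (lt_add_one s) fun x hx =>
        not_lt.2 hx.1.le
    linarith
  have hmono : ∀ a b : ℝ, 0 < a → a < b →
      gaussLine.real (Ioo (-a) a) < gaussLine.real (Ioo (-b) b) := by
    intro a b ha hab
    have hsub : Ioo (-a) a ⊆ Ioo (-b) b := Ioo_subset_Ioo (by linarith) hab.le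
    have h1 := measureReal_sdiff (μ := gaussLine) hsub measurableSet_Ioo
    have h2 : 0 < gaussLine.real (Ioo (-b) b \ Ioo (-a) a) :=
      gaussLine_pos_of_Ioo_subset hab fun x hx =>
        ⟨⟨by linarith [hx.1], hx.2⟩, fun h => absurd h.2 (not_lt.2 hx.1.le)⟩
    linarith
  set f : ℝ → ℝ := fun a => ∫ t in (-a)..a, gaussianPDFReal 0 1 t with hf
  have hcont : Continuous f := by
    have hF : Continuous fun a : ℝ => ∫ t in (0 : ℝ)..a, gaussianPDFReal 0 1 t :=
      intervalIntegral.continuous_primitive (fun a b => hint.intervalIntegrable) 0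
    have : f = fun a => (∫ t in (0 : ℝ)..a, gaussianPDFReal 0 1 t)
        - ∫ t in (0 : ℝ)..(-a), gaussianPDFReal 0 1 t := by
      funext a
      rw [hf, intervalIntegral.integral_interval_sub_left] <;> exact hint.intervalIntegrable
    rw [this]
    exact hF.sub (hF.comp continuous_neg)
  have hlim : Tendsto f atTop (𝓝 1) := by
    have := intervalIntegral_tendsto_integral hint tendsto_neg_atTop_atBot tendsto_id
    rwa [integral_gaussianPDFReal_eq_one 0 one_ne_zero] at this
  obtain ⟨M, hM0, hM⟩ : ∃ M : ℝ, 0 ≤ M ∧ gaussLine.real (Iio s) < f M :=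
    ((eventually_ge_atTop 0).and (hlim.eventually_const_lt hlt)).exists
  obtain ⟨a, ha, hfa⟩ := intermediate_value_Icc hM0 hcont.continuousOn
    (show gaussLine.real (Iio s) ∈ Icc (f 0) (f M) from ⟨by simpa [hf] using hpos.le, hM.le⟩)
  have ha0 : 0 < a := by
    rcases ha.1.eq_or_lt with h | h
    · subst h
      simp only [hf, neg_zero, intervalIntegral.integral_same] at hfa
      linarith
    · exact h
  refine ⟨a, ⟨ha0, by rw [gaussLine_real_Ioo a ha0.le]; exact hfa⟩, ?_⟩
  rintro b ⟨hb0, hb⟩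
  have hae : gaussLine.real (Ioo (-a) a) = gaussLine.real (Iio s) := by
    rw [gaussLine_real_Ioo a ha0.le]; exact hfa
  rcases lt_trichotomy a b with h | h | h
  · linarith [hmono a b ha0 h]
  · exact h.symm
  · linarith [hmono b a hb0 h]

/-- `a(s)`: the positive number with `γ((-a(s), a(s))) = γ((-∞, s))`. -/
def stripRadius (s : ℝ) : ℝ := (existsUnique_stripRadius s).choose

theorem stripRadius_spec (s : ℝ) : 0 < stripRadius s ∧
    gaussLine.real (Ioo (-stripRadius s) (stripRadius s)) = gaussLine.real (Iio s) :=
  (existsUnique_stripRadius s).choose_spec.1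

/-- `μ` and `σ` are the polar decomposition of the Gauss-Green measure `μ_E = σ μ` of `E ⊆ ℝ`:
`μ` is the total variation, `|σ| = 1`, and `∫_E T' dx = ∫ T σ dμ` for every `T ∈ C¹_c(ℝ)`.
Equivalently, the distributional derivative of the indicator function of `E` is the signed
Radon measure `-σ μ`. The pair is unique up to changing `σ` on a `μ`-null set. -/
structure IsGaussGreen (E : Set ℝ) (μ : Measure ℝ) (σ : ℝ → ℝ) : Prop where
  locallyFinite : IsLocallyFiniteMeasure μ
  measurable : Measurable σ
  abs_eq_one : ∀ᵐ x ∂μ, |σ x| = 1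
  integral_deriv : ∀ T : ℝ → ℝ, ContDiff ℝ 1 T → HasCompactSupport T →
    ∫ x in E, deriv T x = ∫ x, T x * σ x ∂μ

/-- Borel sets `E ⊆ ℝ` of locally finite perimeter. -/
def HasLocallyFinitePerimeter (E : Set ℝ) : Prop :=
  MeasurableSet E ∧ ∃ μ σ, IsGaussGreen E μ σ

/-- De Giorgi's reduced boundary `∂*E`: the points `x` in the support of the total variation
`μ` of the Gauss-Green measure `σ μ` at which the limit of
`μ_E(B_r(x)) / |μ_E|(B_r(x))`, as `r ↓ 0`, exists and has length one. -/
def reducedBoundary (E : Set ℝ) : Set ℝ :=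
  {x | ∃ μ σ, IsGaussGreen E μ σ ∧ (∀ r > 0, 0 < μ (Metric.ball x r)) ∧
    ∃ ν : ℝ, |ν| = 1 ∧
      Tendsto (fun r => ⨍ y in Metric.ball x r, σ y ∂μ) (𝓝[>] 0) (𝓝 ν)}

/-- The Gaussian perimeter `P_γ(E) = ∫_{∂*E} exp (-x² / 2) dH⁰(x)` in dimension one (the
normalizing factor `(2π)^(-(n-1)/2)` is `1` for `n = 1`). -/
def gaussPerimeter (E : Set ℝ) : ℝ≥0∞ :=
  ∫⁻ x in reducedBoundary E, ENNReal.ofReal (Real.exp (-x ^ 2 / 2)) ∂(Measure.hausdorffMeasure 0)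

/-- The penalized functional
`𝓕(E) = P_γ(E) + ε √(π/2) |b(E)|² + Λ √(2π) |γ(E) - φ(s)|` with `Λ = s + 1`
(used for `ε ≥ 0` and `s ≥ 0`, so that all terms are nonnegative). -/
def penalizedFunctional (s ε : ℝ) (E : Set ℝ) : ℝ≥0∞ :=
  gaussPerimeter E
    + ENNReal.ofReal (ε * √(Real.pi / 2) * |gaussBarycenter E| ^ 2)
    + ENNReal.ofReal ((s + 1) * √(2 * Real.pi) * |gaussLine.real E - gaussPhi s|)

/-- `E` minimizes the penalized functional among all sets of locally finite perimeter in `ℝ`. -/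
def IsPenalizedMinimizer (s ε : ℝ) (E : Set ℝ) : Prop :=
  HasLocallyFinitePerimeter E ∧
    ∀ F : Set ℝ, HasLocallyFinitePerimeter F →
      penalizedFunctional s ε E ≤ penalizedFunctional s ε F

end

/-! Everything is read off the complement of `E`. Write T for `gaussTail`, w = T(s) and U for
`tailProfile`. On the line the perimeter exp(-x²/2) of a half-line (x, ∞) equals its unnormalized
first moment. So if the complement consists of two outer half-lines of masses m and k, the
functional is U(m) + U(k) + β (U(m) - U(k))² + (s + 1) |m + k - w| with β = ε / (2√(2π)), and the
upper bound on ε says β exp(-s²/2) ≤ 7 / (10 s²). Let V (`minTailEnergy`) be the smaller of the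
energies of half-line and strip.

Reduction to half-lines (`exists_right_halfTail`, `penalizedFunctional_rigidity`): let the energy of
`E` be at most V. A boundary point in (-(s-1), s-1) alone would cost more than V, and so would the
penalty if `E` were null there; hence `E` fills this interval. On each side replace the missing set
by the half-line with the same first moment. If `E` has first moment d beyond its first boundary
point on that side, the perimeter is at least U(m) + 2d, while the mass moves by at most d / (s -
1), which changes the penalty by at most 3d/2. So d = 0 unless the energy exceeds that of the
half-lines.

Two half-lines (`penalizedTailEnergy_cases`, `min_lt_twoTailEnergy`): the slope s + 1 of the penalty
forces m + k = w. Along this line, for w/2 < m < w, the derivative in m has the sign of 2βR - 1 with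
R (`twoTailRatio`) strictly decreasing. The energy can therefore only rise and then fall, and its
minimum is at m = w/2, the strip, or m = w, the half-line.

Explicit competitors attain V, so existence needs no compactness. -/

/-! ### The essential boundary and the Gauss-Green measure -/

/-- The points near which `E` is, up to null sets, neither empty nor everything. -/
def essBoundary (E : Set ℝ) : Set ℝ :=
  {x | ∀ r > 0, volume (Metric.ball x r ∩ E) ≠ 0 ∧ volume (Metric.ball x r \ E) ≠ 0}

theorem IsGaussGreen.locallyIntegrable {E : Set ℝ} {μ : Measure ℝ} {σ : ℝ → ℝ}
    (h : IsGaussGreen E μ σ) : LocallyIntegrable σ μ := by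
  have := h.locallyFinite
  refine (locallyIntegrable_const (1 : ℝ)).mono h.measurable.aestronglyMeasurable ?_
  filter_upwards [h.abs_eq_one] with x hx
  simp [hx]

theorem integral_deriv_eq_zero_of_hasCompactSupport {T : ℝ → ℝ} (hT : ContDiff ℝ 1 T)
    (hc : HasCompactSupport T) : ∫ x, deriv T x = 0 :=
  integral_eq_zero_of_hasDerivAt_of_integrable
    (fun x => (hT.differentiable one_ne_zero x).hasDerivAt)
    ((hT.continuous_deriv le_rfl).integrable_of_hasCompactSupport hc.deriv)
    (hT.continuous.integrable_of_hasCompactSupport hc)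

/-- The Gauss-Green measure vanishes where the set is essentially constant. -/
theorem IsGaussGreen.measure_eq_zero {E : Set ℝ} {μ : Measure ℝ} {σ : ℝ → ℝ}
    (h : IsGaussGreen E μ σ) (hE : MeasurableSet E) {U : Set ℝ} (hU : IsOpen U)
    (hconst : volume (U ∩ E) = 0 ∨ volume (U \ E) = 0) : μ U = 0 := by
  -- For a test function supported in `U`, the integral of its derivative over `E` is 0 or the full
  -- integral, which also vanishes. So `σ` vanishes on `U`, against |σ| = 1.
  have key : ∀ᵐ x ∂μ, x ∈ U → σ x = 0 := by
    refine hU.ae_eq_zero_of_integral_contDiff_smul_eq_zero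
      (h.locallyIntegrable.locallyIntegrableOn U) fun g hg hgc hgU => ?_
    have hg1 : ContDiff ℝ 1 g := hg.of_le (by exact_mod_cast le_top)
    have hd : ∀ x, x ∉ U → deriv g x = 0 := fun x hx =>
      image_eq_zero_of_notMem_tsupport fun h' => hx (hgU (tsupport_deriv_subset h'))
    simp only [smul_eq_mul]
    rw [← h.integral_deriv g hg1 hgc]
    rcases hconst with h0 | h0
    · rw [← integral_indicator hE]
      refine integral_eq_zero_of_ae ?_
      rw [measure_eq_zero_iff_ae_notMem] at h0
      filter_upwards [h0] with x hx
      by_cases hxE : x ∈ E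
      · simp only [indicator_of_mem hxE, Pi.zero_apply]
        exact hd x fun hxU => hx ⟨hxU, hxE⟩
      · simp [hxE]
    · rw [← integral_indicator hE, ← integral_deriv_eq_zero_of_hasCompactSupport hg1 hgc]
      refine integral_congr_ae ?_
      rw [measure_eq_zero_iff_ae_notMem] at h0
      filter_upwards [h0] with x hx
      by_cases hxE : x ∈ E
      · simp [hxE]
      · rw [indicator_of_notMem hxE, hd x fun hxU => hx ⟨hxU, hxE⟩]
  rw [measure_eq_zero_iff_ae_notMem]
  filter_upwards [key, h.abs_eq_one] with x hx h1 hxU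
  rw [hx hxU] at h1
  simp at h1

theorem IsGaussGreen.abs_integral_le {E : Set ℝ} {μ : Measure ℝ} {σ : ℝ → ℝ}
    (h : IsGaussGreen E μ σ) {a b : ℝ} {T : ℝ → ℝ} (hT : ∀ x, |T x| ≤ 1)
    (h0 : ∀ x, x ∉ Icc a b → T x = 0) : |∫ x, T x * σ x ∂μ| ≤ μ.real (Icc a b) := by
  have := h.locallyFinite
  rw [← setIntegral_eq_integral_of_forall_compl_eq_zero (s := Icc a b)
    (fun x hx => by rw [h0 x hx, zero_mul])]
  have := norm_setIntegral_le_of_norm_le_const_ae (μ := μ) (s := Icc a b) (C := 1)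
    (f := fun x => T x * σ x) isCompact_Icc.measure_lt_top ?_
  · simpa using this
  · filter_upwards [ae_restrict_of_ae h.abs_eq_one] with x hx
    rw [Real.norm_eq_abs, abs_mul, hx, mul_one]
    exact hT x

/-- A smoothed step at `p`. Integrating its derivative over `E` gives the mollified indicator of `E`
at `p`; the difference of two such steps has compact support and values in [-1, 1], hence is an
admissible test function. -/
theorem bump_primitive (φ : ContDiffBump (0 : ℝ)) {a b p : ℝ} (ha : a < p - φ.rOut)
    (hb : p + φ.rOut < b) :
    ∃ A : ℝ → ℝ, (∀ t, HasDerivAt A (φ.normed volume (p - t)) t) ∧ (∀ t, 0 ≤ A t) ∧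
      (∀ t, A t ≤ 1) ∧ (∀ t ≤ a, A t = 0) ∧ ∀ t, b ≤ t → A t = 1 := by
  have hcont : Continuous fun t => φ.normed volume (p - t) :=
    φ.continuous_normed.comp (continuous_const.sub continuous_id)
  have hsupp : ∀ t, φ.normed volume (p - t) ≠ 0 → p - φ.rOut < t ∧ t < p + φ.rOut := by
    intro t ht
    have : p - t ∈ Function.support (φ.normed volume) := ht
    rw [φ.support_normed_eq] at this
    simp [abs_lt] at this
    constructor <;> linarith [this.1, this.2]
  have h1 : ∀ t, b ≤ t → ∫ τ in a..t, φ.normed volume (p - τ) = 1 := by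
    intro t ht
    rw [intervalIntegral.integral_eq_integral_of_support_subset]
    · rw [integral_sub_left_eq_self (fun τ => φ.normed volume τ), φ.integral_normed]
    · intro x hx
      have := hsupp x hx
      exact ⟨by linarith [this.1], by linarith [this.2]⟩
  have h0 : ∀ t ≤ a, ∫ τ in a..t, φ.normed volume (p - τ) = 0 := by
    intro t ht
    refine intervalIntegral.integral_zero_ae (Eventually.of_forall fun x hx => ?_)
    rw [uIoc_of_ge ht] at hx
    by_contra hne
    linarith [(hsupp x hne).1, hx.2]
  have hmono : Monotone fun t => ∫ τ in a..t, φ.normed volume (p - τ) := by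
    intro s t hst
    have := intervalIntegral.integral_nonneg (μ := volume) hst
      (fun u _ => φ.nonneg_normed (μ := volume) (p - u))
    have h2 := intervalIntegral.integral_add_adjacent_intervals
      (hcont.intervalIntegrable (μ := volume) a s) (hcont.intervalIntegrable s t)
    simp only
    linarith
  refine ⟨_, fun t => (hcont.integral_hasStrictDerivAt a t).hasDerivAt, fun t => ?_, fun t => ?_,
    h0, h1⟩
  · rcases le_total t a with h | h
    · exact (h0 t h).ge
    · exact (h0 a le_rfl).symm.le.trans (hmono h)
  · rcases le_total t b with h | h
    · exact (hmono h).trans (h1 b le_rfl).le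
    · exact (h1 t h).le

/-- On a bounded interval where `E` is not essentially constant, the Gauss-Green measure is at
least one. -/
theorem IsGaussGreen.one_le_measureReal {E : Set ℝ} {μ : Measure ℝ} {σ : ℝ → ℝ}
    (h : IsGaussGreen E μ σ) (hE : MeasurableSet E) {a b : ℝ}
    (h1 : volume (Ioo a b ∩ E) ≠ 0) (h2 : volume (Ioo a b \ E) ≠ 0) :
    1 ≤ μ.real (Icc a b) := by
  let φ : ℕ → ContDiffBump (0 : ℝ) := fun n =>
    ⟨1 / (n + 1 : ℝ) / 2, 1 / (n + 1 : ℝ), by positivity, half_lt_self (by positivity)⟩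
  have hφ : Tendsto (fun n => (φ n).rOut) atTop (𝓝 0) := tendsto_one_div_add_atTop_nhds_zero_nat
  have hloc : LocallyIntegrable (E.indicator fun _ => (1 : ℝ)) volume :=
    (locallyIntegrable_const (1 : ℝ)).indicator hE
  have hae := ContDiffBump.ae_convolution_tendsto_right_of_locallyIntegrable (φ := φ) (K := 2) hφ
    (Eventually.of_forall fun n => by simp only [φ]; linarith) hloc
  -- Mollifications of the indicator converge almost everywhere, so every non-null set contains a
  -- point of convergence. Taking one inside `E` and one outside makes the test integrals tend to 1
  -- - 0.
  have hex : ∀ S : Set ℝ, volume S ≠ 0 → ∃ p ∈ S, Tendsto (fun i => ∫ t in E,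
      (φ i).normed volume (p - t)) atTop (𝓝 (E.indicator (fun _ => (1 : ℝ)) p)) := by
    intro S hS
    by_contra! hno
    refine hS (measure_mono_null ?_ (ae_iff.1 hae))
    intro p hp hlim
    refine hno p hp (hlim.congr fun i => ?_)
    rw [convolution_eq_swap, ← integral_indicator hE]
    refine integral_congr_ae (Eventually.of_forall fun t => ?_)
    by_cases ht : t ∈ E <;> simp [ht]
  obtain ⟨p, ⟨hpI, hpE⟩, hp⟩ := hex _ h1
  obtain ⟨q, ⟨hqI, hqE⟩, hq⟩ := hex _ h2
  rw [indicator_of_mem hpE] at hp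
  rw [indicator_of_notMem hqE] at hq
  have hlim := hp.sub hq
  rw [sub_zero] at hlim
  refine le_of_tendsto hlim ?_
  have hsmall : ∀ δ > 0, ∀ᶠ n in atTop, (φ n).rOut < δ := fun δ hδ =>
    hφ.eventually_lt_const hδ
  filter_upwards [hsmall (p - a) (by linarith [hpI.1]), hsmall (b - p) (by linarith [hpI.2]),
    hsmall (q - a) (by linarith [hqI.1]), hsmall (b - q) (by linarith [hqI.2])]
    with n n1 n2 n3 n4
  obtain ⟨A, hA, hA0, hA1, hAa, hAb⟩ := bump_primitive (φ n) (a := a) (b := b) (p := p)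
    (by linarith) (by linarith)
  obtain ⟨B, hB, hB0, hB1, hBa, hBb⟩ := bump_primitive (φ n) (a := a) (b := b) (p := q)
    (by linarith) (by linarith)
  have hzero : ∀ x, x ∉ Icc a b → A x - B x = 0 := by
    intro x hx
    rcases le_or_gt x a with hxa | hxa
    · rw [hAa x hxa, hBa x hxa, sub_zero]
    · have : b ≤ x := by
        by_contra! hlt
        exact hx ⟨hxa.le, hlt.le⟩
      rw [hAb x this, hBb x this, sub_self]
  have hderiv : ∀ t, HasDerivAt (fun t => A t - B t)
      ((φ n).normed volume (p - t) - (φ n).normed volume (q - t)) t := fun t =>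
    (hA t).sub (hB t)
  have hd : deriv (fun t => A t - B t) =
      fun t => (φ n).normed volume (p - t) - (φ n).normed volume (q - t) :=
    funext fun t => (hderiv t).deriv
  have hcont : ∀ p : ℝ, Continuous fun t => (φ n).normed volume (p - t) := fun p =>
    (φ n).continuous_normed.comp (continuous_const.sub continuous_id)
  have hint : ∀ p : ℝ, Integrable fun t => (φ n).normed volume (p - t) := fun p =>
    (φ n).integrable_normed.comp_sub_left p
  have hC1 : ContDiff ℝ 1 fun t => A t - B t := by
    rw [contDiff_one_iff_deriv, hd]
    exact ⟨fun t => (hderiv t).differentiableAt, (hcont p).sub (hcont q)⟩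
  have hcs : HasCompactSupport fun t => A t - B t :=
    HasCompactSupport.intro isCompact_Icc hzero
  have hle := h.abs_integral_le (T := fun t => A t - B t)
    (fun x => abs_le.2 ⟨by linarith [hA0 x, hB1 x], by linarith [hA1 x, hB0 x]⟩) hzero
  rw [← h.integral_deriv _ hC1 hcs, hd,
    integral_sub (hint p).integrableOn (hint q).integrableOn] at hle
  exact (le_abs_self _).trans hle

theorem IsGaussGreen.one_le_measure_singleton {E : Set ℝ} {μ : Measure ℝ} {σ : ℝ → ℝ}
    (h : IsGaussGreen E μ σ) (hE : MeasurableSet E) {x : ℝ} (hx : x ∈ essBoundary E) :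
    1 ≤ μ {x} := by
  have := h.locallyFinite
  have hlim : Tendsto (fun n : ℕ => μ (Icc (x - 1 / (n + 1 : ℝ)) (x + 1 / (n + 1 : ℝ)))) atTop
      (𝓝 (μ (⋂ n : ℕ, Icc (x - 1 / (n + 1 : ℝ)) (x + 1 / (n + 1 : ℝ))))) := by
    refine tendsto_measure_iInter_atTop (fun n => measurableSet_Icc.nullMeasurableSet) ?_
      ⟨0, isCompact_Icc.measure_lt_top.ne⟩
    intro m n hmn
    have : 1 / (n + 1 : ℝ) ≤ 1 / (m + 1 : ℝ) := by gcongr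
    exact Icc_subset_Icc (by linarith) (by linarith)
  have hI : ⋂ n : ℕ, Icc (x - 1 / (n + 1 : ℝ)) (x + 1 / (n + 1 : ℝ)) = {x} := by
    ext y
    simp only [mem_iInter, mem_Icc, mem_singleton_iff]
    refine ⟨fun hy => ?_, fun hy n => ?_⟩
    · have hle : |y - x| ≤ 0 := ge_of_tendsto' tendsto_one_div_add_atTop_nhds_zero_nat
        fun n => abs_le.2 ⟨by linarith [(hy n).1], by linarith [(hy n).2]⟩
      have := abs_nonpos_iff.1 hle
      linarith
    · have : (0 : ℝ) < 1 / (n + 1 : ℝ) := by positivity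
      subst hy
      exact ⟨by linarith, by linarith⟩
  rw [hI] at hlim
  refine ge_of_tendsto' hlim fun n => ?_
  have hx' := hx (1 / (n + 1 : ℝ)) (by positivity)
  rw [Real.ball_eq_Ioo] at hx'
  have := h.one_le_measureReal hE hx'.1 hx'.2
  rw [measureReal_def] at this
  rw [← ENNReal.ofReal_one]
  exact ENNReal.ofReal_le_of_le_toReal this

/-- Each essential boundary point is an atom of mass at least 1, and `μ` is finite on compact sets.
-/
theorem IsGaussGreen.finite_essBoundary_inter {E : Set ℝ} {μ : Measure ℝ} {σ : ℝ → ℝ}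
    (h : IsGaussGreen E μ σ) (hE : MeasurableSet E) (a b : ℝ) :
    (essBoundary E ∩ Icc a b).Finite := by
  have := h.locallyFinite
  by_contra hinf
  have htop := Set.Infinite.meas_eq_top (μ := μ) hinf
    ⟨1, one_ne_zero, fun x hx => h.one_le_measure_singleton hE hx.1⟩
  exact ((measure_mono inter_subset_right).trans_lt isCompact_Icc.measure_lt_top).ne htop

/-- A set is essentially constant on every connected set free of essential boundary points. -/
theorem null_or_conull_of_disjoint_essBoundary {E U : Set ℝ} (hU : IsPreconnected U)
    (h : ∀ x ∈ U, x ∉ essBoundary E) :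
    volume (U ∩ E) = 0 ∨ volume (U \ E) = 0 := by
  have hopen : ∀ S : Set ℝ, IsOpen {x | ∃ r > 0, volume (Metric.ball x r ∩ S) = 0} := by
    intro S
    rw [Metric.isOpen_iff]
    rintro x ⟨r, hr, h0⟩
    refine ⟨r / 2, by positivity, fun y hy => ⟨r / 2, by positivity, measure_mono_null ?_ h0⟩⟩
    refine inter_subset_inter_left _ (Metric.ball_subset_ball' ?_)
    linarith [Metric.mem_ball.1 hy]
  have hnull : ∀ S : Set ℝ, U ⊆ {x | ∃ r > 0, volume (Metric.ball x r ∩ S) = 0} →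
      volume (U ∩ S) = 0 := by
    intro S hS
    refine measure_null_of_locally_null _ fun x hx => ?_
    obtain ⟨r, hr, h0⟩ := hS hx.1
    refine ⟨Metric.ball x r ∩ (U ∩ S),
      inter_mem (mem_nhdsWithin_of_mem_nhds (Metric.ball_mem_nhds x hr)) self_mem_nhdsWithin,
      measure_mono_null ?_ h0⟩
    exact inter_subset_inter_right _ inter_subset_right
  have hcover : U ⊆ {x | ∃ r > 0, volume (Metric.ball x r ∩ E) = 0} ∪
      {x | ∃ r > 0, volume (Metric.ball x r ∩ Eᶜ) = 0} := by
    intro x hx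
    have := h x hx
    simp only [essBoundary, mem_ofPred_eq, not_forall] at this
    obtain ⟨r, hr, h0⟩ := this
    by_cases h1 : volume (Metric.ball x r ∩ E) = 0
    · exact Or.inl ⟨r, hr, h1⟩
    · refine Or.inr ⟨r, hr, ?_⟩
      rw [← sdiff_eq]
      by_contra h2
      exact h0 ⟨h1, h2⟩
  -- A point in both sets would have a null ball around it. Connectedness then leaves only one of
  -- the two open sets.
  have hdisj : Disjoint {x | ∃ r > 0, volume (Metric.ball x r ∩ E) = 0}
      {x | ∃ r > 0, volume (Metric.ball x r ∩ Eᶜ) = 0} := by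
    rw [Set.disjoint_left]
    rintro x ⟨r, hr, h0⟩ ⟨r', hr', h0'⟩
    have : volume (Metric.ball x (min r r')) = 0 := by
      refine measure_mono_null ?_ (measure_union_null h0 h0')
      intro y hy
      have hy1 := Metric.ball_subset_ball (min_le_left r r') hy
      have hy2 := Metric.ball_subset_ball (min_le_right r r') hy
      by_cases hyE : y ∈ E
      · exact Or.inl ⟨hy1, hyE⟩
      · exact Or.inr ⟨hy2, hyE⟩
    exact (Metric.measure_ball_pos volume x (lt_min hr hr')).ne' this
  rcases IsPreconnected.subset_or_subset (hopen E) (hopen Eᶜ) hdisj hcover hU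
    with h1 | h1
  · exact Or.inl (hnull _ h1)
  · exact Or.inr (by rw [sdiff_eq]; exact hnull _ h1)

theorem reducedBoundary_subset_essBoundary {E : Set ℝ} (hE : MeasurableSet E) :
    reducedBoundary E ⊆ essBoundary E := by
  rintro x ⟨μ, σ, h, hpos, -⟩ r hr
  constructor <;> intro h0
  · exact (hpos r hr).ne' (h.measure_eq_zero hE Metric.isOpen_ball (Or.inl h0))
  · exact (hpos r hr).ne' (h.measure_eq_zero hE Metric.isOpen_ball (Or.inr h0))

/-- Essential boundary points are isolated, and `μ` vanishes between them. Hence small balls around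
`x` see only the atom at `x`, and the averages of `σ` are constantly `σ x`. -/
theorem essBoundary_subset_reducedBoundary {E : Set ℝ} (hE : HasLocallyFinitePerimeter E) :
    essBoundary E ⊆ reducedBoundary E := by
  obtain ⟨hm, μ, σ, h⟩ := hE
  have := h.locallyFinite
  intro x hx
  have hone := h.one_le_measure_singleton hm hx
  have hpos : ∀ r > 0, 0 < μ (Metric.ball x r) := fun r hr =>
    zero_lt_one.trans_le (hone.trans (measure_mono (singleton_subset_iff.2
      (Metric.mem_ball_self hr))))
  have habs : |σ x| = 1 := by
    by_contra hne
    have : μ {x} = 0 := measure_mono_null (singleton_subset_iff.2 hne) (ae_iff.1 h.abs_eq_one)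
    simp [this] at hone
  obtain ⟨δ, hδ, hiso⟩ : ∃ δ > 0, ∀ y ∈ Metric.ball x δ, y ∈ essBoundary E → y = x := by
    have hfin := (h.finite_essBoundary_inter hm (x - 1) (x + 1)).subset
      (sdiff_subset (s := _) (t := {x}))
    obtain ⟨δ, hδ, hball⟩ := Metric.isOpen_iff.1 hfin.isClosed.isOpen_compl x (by simp)
    refine ⟨min δ 1, by positivity, fun y hy hyE => ?_⟩
    by_contra hne
    refine hball (Metric.ball_subset_ball (min_le_left _ _) hy) ⟨⟨hyE, ?_⟩, hne⟩
    have := Metric.ball_subset_ball (min_le_right _ _) hy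
    rw [Real.ball_eq_Ioo] at this
    exact Ioo_subset_Icc_self this
  have hside : ∀ r, 0 < r → r ≤ δ → μ (Metric.ball x r \ {x}) = 0 := by
    intro r _ hrδ
    have hz : ∀ a b, Ioo a b ⊆ Metric.ball x δ \ {x} → μ (Ioo a b) = 0 := by
      intro a b hab
      refine h.measure_eq_zero hm isOpen_Ioo 
        (null_or_conull_of_disjoint_essBoundary isPreconnected_Ioo ?_)
      intro y hy hyE
      exact (hab hy).2 (hiso y (hab hy).1 hyE)
    rw [Real.ball_eq_Ioo] at hz
    refine measure_mono_null ?_ (measure_union_null (hz (x - r) x ?_) (hz x (x + r) ?_))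
    · rintro y ⟨hy, hne⟩
      rw [Real.ball_eq_Ioo] at hy
      rcases lt_or_gt_of_ne hne with h1 | h1
      · exact Or.inl ⟨hy.1, h1⟩
      · exact Or.inr ⟨h1, hy.2⟩
    · exact fun y hy => ⟨⟨by linarith [hy.1], by linarith [hy.2]⟩, hy.2.ne⟩
    · exact fun y hy => ⟨⟨by linarith [hy.1], by linarith [hy.2]⟩, hy.1.ne'⟩
  refine ⟨μ, σ, h, hpos, σ x, habs, ?_⟩
  refine tendsto_const_nhds.congr' ?_
  filter_upwards [Ioc_mem_nhdsGT hδ] with r hr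
  have hae : Metric.ball x r =ᵐ[μ] ({x} : Set ℝ) := by
    refine ae_eq_set.2 ⟨hside r hr.1 hr.2, ?_⟩
    rw [sdiff_eq_empty.2 (singleton_subset_iff.2 (Metric.mem_ball_self hr.1)), measure_empty]
  rw [setAverage_congr hae, setAverage_eq, integral_singleton, smul_smul, inv_mul_cancel₀, one_smul]
  rw [measureReal_def]
  refine (ENNReal.toReal_pos (zero_lt_one.trans_le hone).ne' ?_).ne'
  exact isCompact_singleton.measure_lt_top.ne

theorem reducedBoundary_eq_essBoundary {E : Set ℝ} (hE : HasLocallyFinitePerimeter E) :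
    reducedBoundary E = essBoundary E :=
  (reducedBoundary_subset_essBoundary hE.1).antisymm (essBoundary_subset_reducedBoundary hE)

/-! ### Gaussian perimeter as a sum over boundary points -/

/-- A finite set of essential boundary points bounds the Gaussian perimeter from below. -/
theorem sum_le_gaussPerimeter {E : Set ℝ} (hE : HasLocallyFinitePerimeter E) (A : Finset ℝ)
    (hA : ∀ x ∈ A, x ∈ essBoundary E) :
    ENNReal.ofReal (∑ x ∈ A, Real.exp (-x ^ 2 / 2)) ≤ gaussPerimeter E := by
  rw [gaussPerimeter, reducedBoundary_eq_essBoundary hE,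
    ENNReal.ofReal_sum_of_nonneg fun x _ => (Real.exp_pos _).le]
  have := lintegral_finset (μ := Measure.hausdorffMeasure (X := ℝ) 0) A
    fun x => ENNReal.ofReal (Real.exp (-x ^ 2 / 2))
  simp only [Measure.hausdorffMeasure_zero_singleton, mul_one] at this
  rw [← this]
  exact lintegral_mono_set hA

theorem gaussPerimeter_le_sum {E : Set ℝ} (hE : MeasurableSet E) (A : Finset ℝ)
    (hA : ∀ x ∈ essBoundary E, x ∈ A) :
    gaussPerimeter E ≤ ENNReal.ofReal (∑ x ∈ A, Real.exp (-x ^ 2 / 2)) := by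
  rw [gaussPerimeter, ENNReal.ofReal_sum_of_nonneg fun x _ => (Real.exp_pos _).le]
  have := lintegral_finset (μ := Measure.hausdorffMeasure (X := ℝ) 0) A
    fun x => ENNReal.ofReal (Real.exp (-x ^ 2 / 2))
  simp only [Measure.hausdorffMeasure_zero_singleton, mul_one] at this
  rw [← this]
  exact lintegral_mono_set fun x hx => hA x (reducedBoundary_subset_essBoundary hE hx)

theorem essBoundary_subset_frontier (E : Set ℝ) : essBoundary E ⊆ frontier E := by
  intro x hx
  rw [frontier_eq_closure_inter_closure]
  constructor <;> rw [Metric.mem_closure_iff] <;> intro r hr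
  · obtain ⟨y, hy, hyE⟩ := nonempty_of_measure_ne_zero (hx r hr).1
    exact ⟨y, hyE, by rw [dist_comm]; exact hy⟩
  · obtain ⟨y, hy, hyE⟩ := nonempty_of_measure_ne_zero (hx r hr).2
    exact ⟨y, hyE, by rw [dist_comm]; exact hy⟩

theorem hasLocallyFinitePerimeter_Iio (s : ℝ) : HasLocallyFinitePerimeter (Iio s) := by
  refine ⟨measurableSet_Iio, Measure.dirac s, fun _ => 1, ⟨inferInstance, measurable_const,
    by simp, fun T hT hc => ?_⟩⟩
  rw [← integral_Iic_eq_integral_Iio, hc.integral_Iic_deriv_eq hT]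
  simp

theorem hasLocallyFinitePerimeter_Ioo {a : ℝ} (ha : 0 < a) :
    HasLocallyFinitePerimeter (Ioo (-a) a) := by
  refine ⟨measurableSet_Ioo, Measure.dirac a + Measure.dirac (-a), fun x => if 0 < x then 1 else -1,
    ⟨inferInstance, Measurable.ite measurableSet_Ioi measurable_const measurable_const, ?_,
      fun T hT hc => ?_⟩⟩
  · refine Eventually.of_forall fun x => ?_
    by_cases h : 0 < x <;> simp [h]
  · rw [← integral_Ioc_eq_integral_Ioo, ← intervalIntegral.integral_of_le (by linarith),
      intervalIntegral.integral_deriv_eq_sub (fun x _ => hT.differentiable one_ne_zero x)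
        ((hT.continuous_deriv le_rfl).intervalIntegrable _ _),
      integral_add_measure]
    · simp [ha, ha.le, sub_eq_add_neg]
    · exact integrable_dirac (by simp)
    · exact integrable_dirac (by simp)

/-! ### The Gaussian tail and Mills' bounds -/

/-- The unnormalized Gaussian tail `∫_x^∞ exp (-t² / 2) dt`. -/
noncomputable def gaussTail (x : ℝ) : ℝ := ∫ t in Ioi x, Real.exp (-t ^ 2 / 2)

theorem integrable_exp_neg_sq_half : Integrable fun t : ℝ => Real.exp (-t ^ 2 / 2) := by
  refine (integrable_exp_neg_mul_sq (b := 1 / 2) (by norm_num)).congr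
    (Eventually.of_forall fun t => ?_)
  ring_nf

theorem integrable_mul_exp_neg_sq_half : Integrable fun t : ℝ => t * Real.exp (-t ^ 2 / 2) := by
  refine (integrable_mul_exp_neg_mul_sq (b := 1 / 2) (by norm_num)).congr
    (Eventually.of_forall fun t => ?_)
  ring_nf

theorem hasDerivAt_exp_neg_sq_half (x : ℝ) :
    HasDerivAt (fun t : ℝ => Real.exp (-t ^ 2 / 2)) (-x * Real.exp (-x ^ 2 / 2)) x := by
  have h : HasDerivAt (fun t : ℝ => -t ^ 2 / 2) (-x) x :=
    ((hasDerivAt_pow 2 x).neg.div_const 2).congr_deriv (by norm_num; ring)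
  exact h.exp.congr_deriv (mul_comm _ _)

theorem exp_neg_sq_half_le_iff {x y : ℝ} (hx : 0 ≤ x) (hy : 0 ≤ y) :
    Real.exp (-x ^ 2 / 2) ≤ Real.exp (-y ^ 2 / 2) ↔ y ≤ x := by
  rw [Real.exp_le_exp]
  constructor
  · intro h
    exact (sq_le_sq₀ hy hx).1 (by linarith)
  · intro h
    have := (sq_le_sq₀ hy hx).2 h
    linarith

theorem exp_neg_sq_half_lt_iff {x y : ℝ} (hx : 0 ≤ x) (hy : 0 ≤ y) :
    Real.exp (-x ^ 2 / 2) < Real.exp (-y ^ 2 / 2) ↔ y < x := by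
  rw [← not_le, exp_neg_sq_half_le_iff hy hx, not_le]

theorem tendsto_exp_neg_sq_half : Tendsto (fun t : ℝ => Real.exp (-t ^ 2 / 2)) atTop (𝓝 0) := by
  refine Real.tendsto_exp_atBot.comp ?_
  have h : Tendsto (fun t : ℝ => t ^ 2 / 2) atTop atTop :=
    (tendsto_pow_atTop two_ne_zero).atTop_div_const two_pos
  refine (tendsto_neg_atTop_atBot.comp h).congr fun t => ?_
  simp only [Function.comp]
  ring

theorem integral_Ioi_mul_exp_neg_sq_half (x : ℝ) :
    ∫ t in Ioi x, t * Real.exp (-t ^ 2 / 2) = Real.exp (-x ^ 2 / 2) := by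
  rw [integral_Ioi_of_hasDerivAt_of_tendsto' (f := fun t => -Real.exp (-t ^ 2 / 2)) (m := 0)
    (fun t _ => (hasDerivAt_exp_neg_sq_half t).neg.congr_deriv (by ring))
    integrable_mul_exp_neg_sq_half.integrableOn ?_]
  · ring
  · simpa using tendsto_exp_neg_sq_half.neg

theorem gaussTail_eq_sub (x : ℝ) :
    gaussTail x = gaussTail 0 - ∫ t in (0 : ℝ)..x, Real.exp (-t ^ 2 / 2) := by
  have h := intervalIntegral.integral_interval_add_Ioi (a := 0) (b := x)
    (f := fun t : ℝ => Real.exp (-t ^ 2 / 2)) (μ := volume)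
    integrable_exp_neg_sq_half.integrableOn integrable_exp_neg_sq_half.integrableOn
  rw [gaussTail, gaussTail, ← h]
  ring

theorem hasStrictDerivAt_gaussTail (x : ℝ) :
    HasStrictDerivAt gaussTail (-Real.exp (-x ^ 2 / 2)) x := by
  have hc : Continuous fun t : ℝ => Real.exp (-t ^ 2 / 2) := by fun_prop
  rw [funext gaussTail_eq_sub]
  exact (hc.integral_hasStrictDerivAt 0 x).const_sub _

theorem hasDerivAt_gaussTail (x : ℝ) : HasDerivAt gaussTail (-Real.exp (-x ^ 2 / 2)) x :=
  (hasStrictDerivAt_gaussTail x).hasDerivAt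

theorem continuous_gaussTail : Continuous gaussTail :=
  continuous_iff_continuousAt.2 fun x => (hasDerivAt_gaussTail x).continuousAt

theorem strictAnti_gaussTail : StrictAnti gaussTail :=
  strictAnti_of_deriv_neg fun x => by
    rw [(hasDerivAt_gaussTail x).deriv]
    exact neg_neg_of_pos (Real.exp_pos _)

/-- On (x, ∞) the factor t / x is at least 1, and t exp(-t²/2) integrates exactly. -/
theorem gaussTail_le {x : ℝ} (hx : 0 < x) : gaussTail x ≤ Real.exp (-x ^ 2 / 2) / x := by
  rw [← integral_Ioi_mul_exp_neg_sq_half x, gaussTail, div_eq_inv_mul, ← integral_const_mul]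
  refine setIntegral_mono_on integrable_exp_neg_sq_half.integrableOn
    (integrable_mul_exp_neg_sq_half.integrableOn.const_mul _) measurableSet_Ioi fun t ht => ?_
  rw [← mul_assoc, inv_mul_eq_div]
  exact le_mul_of_one_le_left (Real.exp_pos _).le ((one_le_div hx).2 (mem_Ioi.1 ht).le)

theorem gaussTail_nonneg (x : ℝ) : 0 ≤ gaussTail x :=
  integral_nonneg fun _ => (Real.exp_pos _).le

theorem gaussTail_pos (x : ℝ) : 0 < gaussTail x :=
  (gaussTail_nonneg (x + 1)).trans_lt (strictAnti_gaussTail (lt_add_one x))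

theorem tendsto_gaussTail : Tendsto gaussTail atTop (𝓝 0) := by
  refine squeeze_zero' (Eventually.of_forall gaussTail_nonneg) ?_ tendsto_exp_neg_sq_half
  filter_upwards [eventually_ge_atTop 1] with x hx
  exact (gaussTail_le (by linarith)).trans (div_le_self (Real.exp_pos _).le hx)

/-- The difference of the two sides is decreasing and tends to 0 at infinity. -/
theorem le_gaussTail (x : ℝ) :
    x / (x ^ 2 + 1) * Real.exp (-x ^ 2 / 2) ≤ gaussTail x := by
  have hd : ∀ t : ℝ, HasDerivAt (fun t => gaussTail t - t / (t ^ 2 + 1) * Real.exp (-t ^ 2 / 2))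
      (-Real.exp (-t ^ 2 / 2) * (2 / (t ^ 2 + 1) ^ 2)) t := by
    intro t
    have hne : t ^ 2 + 1 ≠ 0 := by positivity
    have h1 : HasDerivAt (fun t : ℝ => t / (t ^ 2 + 1)) ((1 * (t ^ 2 + 1) - t * (2 * t))
        / (t ^ 2 + 1) ^ 2) t := by
      refine (hasDerivAt_id t).div ?_ hne
      simpa using (hasDerivAt_pow 2 t).add_const 1
    refine ((hasDerivAt_gaussTail t).sub (h1.mul (hasDerivAt_exp_neg_sq_half t))).congr_deriv ?_
    field_simp
    ring
  have hanti : Antitone fun t => gaussTail t - t / (t ^ 2 + 1) * Real.exp (-t ^ 2 / 2) :=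
    antitone_of_deriv_nonpos (fun t => (hd t).differentiableAt) fun t => by
      rw [(hd t).deriv, neg_mul]
      exact neg_nonpos.2 (by positivity)
  have hlim : Tendsto (fun t => gaussTail t - t / (t ^ 2 + 1) * Real.exp (-t ^ 2 / 2)) atTop
      (𝓝 0) := by
    have h2 : Tendsto (fun t : ℝ => t / (t ^ 2 + 1) * Real.exp (-t ^ 2 / 2)) atTop (𝓝 0) := by
      refine squeeze_zero' ?_ ?_ tendsto_exp_neg_sq_half
      · filter_upwards [eventually_ge_atTop 0] with t ht
        positivity
      · filter_upwards with t
        refine mul_le_of_le_one_left (Real.exp_pos _).le ?_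
        rw [div_le_one (by positivity)]
        nlinarith [sq_nonneg (t - 1)]
    simpa using tendsto_gaussTail.sub h2
  have := hanti.le_of_tendsto hlim x
  linarith

theorem exists_gaussTail_eq {m : ℝ} (h0 : 0 < m) (h1 : m < gaussTail 0) :
    ∃ x, 0 < x ∧ gaussTail x = m := by
  obtain ⟨M, hM0, hM⟩ := ((eventually_ge_atTop 0).and
    (tendsto_gaussTail.eventually_lt_const h0)).exists
  obtain ⟨x, hx, hxm⟩ := intermediate_value_Icc' hM0 continuous_gaussTail.continuousOn
    ⟨hM.le, h1.le⟩
  refine ⟨x, lt_of_le_of_ne hx.1 ?_, hxm⟩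
  rintro rfl
  linarith

/-! ### Quantile and isoperimetric profile -/

/-- The positive number whose tail has mass `m`. -/
noncomputable def tailQuantile : ℝ → ℝ := Function.invFunOn gaussTail (Ioi 0)

theorem tailQuantile_gaussTail {x : ℝ} (hx : 0 < x) : tailQuantile (gaussTail x) = x :=
  strictAnti_gaussTail.injective.injOn.leftInvOn_invFunOn hx

/-- The unnormalized isoperimetric profile for small masses. -/
noncomputable def tailProfile (m : ℝ) : ℝ :=
  if m ≤ 0 then 0 else Real.exp (-tailQuantile m ^ 2 / 2)

theorem tailProfile_of_nonpos {m : ℝ} (h : m ≤ 0) : tailProfile m = 0 := if_pos h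

theorem tailProfile_of_pos {m : ℝ} (h : 0 < m) :
    tailProfile m = Real.exp (-tailQuantile m ^ 2 / 2) := if_neg h.not_ge

theorem tailProfile_gaussTail {x : ℝ} (hx : 0 < x) :
    tailProfile (gaussTail x) = Real.exp (-x ^ 2 / 2) := by
  rw [tailProfile_of_pos (gaussTail_pos x), tailQuantile_gaussTail hx]

theorem tailProfile_nonneg (m : ℝ) : 0 ≤ tailProfile m := by
  unfold tailProfile
  split_ifs
  · exact le_rfl
  · exact (Real.exp_pos _).le

theorem tailQuantile_pos {m : ℝ} (h0 : 0 < m) (h1 : m < gaussTail 0) : 0 < tailQuantile m := by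
  obtain ⟨x, hx, rfl⟩ := exists_gaussTail_eq h0 h1
  rwa [tailQuantile_gaussTail hx]

theorem gaussTail_tailQuantile {m : ℝ} (h0 : 0 < m) (h1 : m < gaussTail 0) :
    gaussTail (tailQuantile m) = m := by
  obtain ⟨x, hx, rfl⟩ := exists_gaussTail_eq h0 h1
  rw [tailQuantile_gaussTail hx]

theorem hasDerivAt_tailQuantile {m : ℝ} (h0 : 0 < m) (h1 : m < gaussTail 0) :
    HasDerivAt tailQuantile (-(tailProfile m)⁻¹) m := by
  obtain ⟨x, hx, rfl⟩ := exists_gaussTail_eq h0 h1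
  rw [tailProfile_gaussTail hx, ← inv_neg]
  refine ((hasStrictDerivAt_gaussTail x).to_local_left_inverse
    (neg_ne_zero.2 (Real.exp_pos _).ne') ?_).hasDerivAt
  filter_upwards [Ioi_mem_nhds hx] with y hy using tailQuantile_gaussTail hy

/-- The Gaussian factor -x exp(-x²/2) cancels against the derivative -exp(x²/2) of the quantile.
Since the quantile decreases, the profile is strictly concave. -/
theorem hasDerivAt_tailProfile {m : ℝ} (h0 : 0 < m) (h1 : m < gaussTail 0) :
    HasDerivAt tailProfile (tailQuantile m) m := by
  have h := (hasDerivAt_exp_neg_sq_half (tailQuantile m)).comp m (hasDerivAt_tailQuantile h0 h1)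
  have hev : (fun t : ℝ => Real.exp (-t ^ 2 / 2)) ∘ tailQuantile =ᶠ[𝓝 m] tailProfile := by
    filter_upwards [Ioi_mem_nhds h0] with k hk
    rw [tailProfile_of_pos hk]
    rfl
  refine (h.congr_of_eventuallyEq hev.symm).congr_deriv ?_
  rw [tailProfile_of_pos h0]
  field_simp

theorem tailQuantile_lt {m k : ℝ} (h0 : 0 < m) (hmk : m < k) (h1 : k < gaussTail 0) :
    tailQuantile k < tailQuantile m := by
  rw [← strictAnti_gaussTail.lt_iff_gt, gaussTail_tailQuantile h0 (hmk.trans h1),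
    gaussTail_tailQuantile (h0.trans hmk) h1]
  exact hmk

theorem tailProfile_lt {m k : ℝ} (h0 : 0 ≤ m) (hmk : m < k) (h1 : k < gaussTail 0) :
    tailProfile m < tailProfile k := by
  have hk : 0 < k := h0.trans_lt hmk
  rw [tailProfile_of_pos hk]
  rcases h0.eq_or_lt with rfl | h0
  · rw [tailProfile_of_nonpos le_rfl]
    exact Real.exp_pos _
  · rw [tailProfile_of_pos h0, exp_neg_sq_half_lt_iff (tailQuantile_pos h0 (hmk.trans h1)).le
      (tailQuantile_pos hk h1).le]
    exact tailQuantile_lt h0 hmk h1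

theorem tailProfile_le {m k : ℝ} (h0 : 0 ≤ m) (hmk : m ≤ k) (h1 : k < gaussTail 0) :
    tailProfile m ≤ tailProfile k := by
  rcases hmk.eq_or_lt with rfl | h
  · exact le_rfl
  · exact (tailProfile_lt h0 h h1).le

/-- At mass 0 the assigned value 0 is the correct limit, since the half-line escapes to infinity.
This makes the single half-line the endpoint of the two-half-line family. -/
theorem continuousAt_tailProfile {m : ℝ} (h1 : m < gaussTail 0) : ContinuousAt tailProfile m := by
  rcases lt_trichotomy m 0 with h | rfl | h
  · refine (continuousAt_const (y := (0 : ℝ))).congr ?_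
    filter_upwards [Iio_mem_nhds h] with k hk
    exact (tailProfile_of_nonpos (mem_Iio.1 hk).le).symm
  · rw [ContinuousAt, tailProfile_of_nonpos le_rfl, Metric.tendsto_nhds]
    intro δ hδ
    obtain ⟨X, hX0, hX⟩ := ((eventually_gt_atTop 0).and
      (tendsto_exp_neg_sq_half.eventually_lt_const hδ)).exists
    filter_upwards [Iio_mem_nhds (gaussTail_pos X)] with k hk
    rw [Real.dist_eq, sub_zero, abs_of_nonneg (tailProfile_nonneg k)]
    rcases le_or_gt k 0 with h | h
    · rwa [tailProfile_of_nonpos h]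
    · refine (tailProfile_le h.le (mem_Iio.1 hk).le (strictAnti_gaussTail hX0)).trans_lt ?_
      rwa [tailProfile_gaussTail hX0]
  · exact (hasDerivAt_tailProfile h h1).continuousAt

theorem tailProfile_sub_le {m k : ℝ} (h0 : 0 < m) (hmk : m < k) (h1 : k < gaussTail 0) :
    tailProfile k - tailProfile m ≤ tailQuantile m * (k - m) := by
  obtain ⟨c, hc, hceq⟩ := exists_hasDerivAt_eq_slope tailProfile tailQuantile hmk
    (fun t ht => (continuousAt_tailProfile (ht.2.trans_lt h1)).continuousWithinAt)
    (fun t ht => hasDerivAt_tailProfile (h0.trans ht.1) (ht.2.trans h1))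
  rw [eq_div_iff (by linarith)] at hceq
  rw [← hceq]
  exact mul_le_mul_of_nonneg_right (tailQuantile_lt h0 hc.1 (hc.2.trans h1)).le (by linarith)

/-! ### Splitting a fixed mass between two half-lines -/

/-- Rearranged, the claim is y (l - 1 + e^(-l)) < x (e^l - 1 - l). The left side is at most x (1 +
l/4) l²/2 and the right side at least x (l²/2 + l³/6); the gap is x l³/24. -/
theorem mul_log_ratio_lt {x y l : ℝ} (hx : 2 ≤ x) (hy : 0 ≤ y) (hl : 0 < l)
    (hxy : y ^ 2 = x ^ 2 + 2 * l) :
    (x + y) * l < y * (1 - Real.exp (-l)) + x * (Real.exp l - 1) := by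
  have hD : 1 + l + l ^ 2 / 2 + l ^ 3 / 6 ≤ Real.exp l := by
    have := Real.sum_le_exp_of_nonneg hl.le 4
    simp [Finset.sum_range_succ, Nat.factorial] at this
    linarith
  have hN : Real.exp (-l) ≤ 1 - l + l ^ 2 / 2 := by
    have h2 := Real.quadratic_le_exp_of_nonneg hl.le
    have h3 : Real.exp (-l) * Real.exp l = 1 := by rw [← Real.exp_add]; simp
    have h4 : 0 < 1 - l + l ^ 2 / 2 := by nlinarith [sq_nonneg (l - 1)]
    have h5 : 1 ≤ (1 - l + l ^ 2 / 2) * Real.exp l := by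
      calc (1 : ℝ) ≤ (1 - l + l ^ 2 / 2) * (1 + l + l ^ 2 / 2) := by
            have : (1 - l + l ^ 2 / 2) * (1 + l + l ^ 2 / 2) = 1 + l ^ 4 / 4 := by ring
            rw [this]
            linarith [pow_pos hl 4]
        _ ≤ _ := by gcongr
    exact le_of_mul_le_mul_right (h3.le.trans h5) (Real.exp_pos l)
  -- This is where x ≥ 2 enters: x² (1 + l/4)² exceeds x² + 2l once x² ≥ 4.
  have hyx : y ≤ x * (1 + l / 4) := by
    refine (sq_le_sq₀ hy (by positivity)).1 ?_
    rw [hxy]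
    nlinarith [mul_nonneg hl.le (mul_self_nonneg x), mul_le_mul hx hx (by norm_num) (by linarith),
      mul_nonneg (sq_nonneg l) (mul_self_nonneg x)]
  have hx0 : 0 < x := by linarith
  have h1 : y * (l - 1 + Real.exp (-l)) ≤ x * (1 + l / 4) * (l ^ 2 / 2) := by
    calc y * (l - 1 + Real.exp (-l)) ≤ y * (l ^ 2 / 2) := by
          apply mul_le_mul_of_nonneg_left _ hy; linarith
      _ ≤ _ := by gcongr
  have h2 : x * (l ^ 2 / 2 + l ^ 3 / 6) ≤ x * (Real.exp l - 1 - l) := by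
    apply mul_le_mul_of_nonneg_left _ hx0.le; linarith
  have h3 : 0 < x * l ^ 3 := by positivity
  nlinarith

/-- This is exactly the negativity of the numerator in the derivative of `twoTailRatio`. With l =
(y² - x²)/2 the two exponentials differ by the factor e^(-l), which reduces it to
`mul_log_ratio_lt`. -/
theorem profile_ratio_ineq {x y : ℝ} (hx : 2 ≤ x) (hxy : x < y) :
    (x + y) ^ 2 * (y - x) <
      2 * (Real.exp (-x ^ 2 / 2) - Real.exp (-y ^ 2 / 2)) *
        (y / Real.exp (-x ^ 2 / 2) + x / Real.exp (-y ^ 2 / 2)) := by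
  set l := (y ^ 2 - x ^ 2) / 2 with hl
  have hl0 : 0 < l := by
    rw [hl]
    nlinarith
  have h := mul_log_ratio_lt hx (by linarith) hl0 (by rw [hl]; ring : y ^ 2 = x ^ 2 + 2 * l)
  have hv : Real.exp (-y ^ 2 / 2) = Real.exp (-x ^ 2 / 2) * Real.exp (-l) := by
    rw [← Real.exp_add, hl]
    ring_nf
  have hinv : Real.exp l = (Real.exp (-l))⁻¹ := by rw [Real.exp_neg, inv_inv]
  rw [hinv] at h
  have hu := Real.exp_pos (-x ^ 2 / 2)
  have hw := Real.exp_pos (-l)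
  rw [hv]
  generalize Real.exp (-x ^ 2 / 2) = u at *
  generalize Real.exp (-l) = w at *
  have e1 : 2 * (u - u * w) * (y / u + x / (u * w)) = 2 * (y * (1 - w) + x * (w⁻¹ - 1)) := by
    field_simp
  have e2 : (x + y) ^ 2 * (y - x) = 2 * ((x + y) * l) := by
    rw [hl]; ring
  rw [e1, e2]
  linarith

/-- The energy of two half-lines of total mass `w`, one of which has mass `m`. -/
noncomputable def twoTailEnergy (β w m : ℝ) : ℝ :=
  tailProfile m + tailProfile (w - m) + β * (tailProfile m - tailProfile (w - m)) ^ 2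

/-- The quantity whose size decides the sign of the derivative of `twoTailEnergy`. -/
noncomputable def twoTailRatio (w m : ℝ) : ℝ :=
  (tailProfile m - tailProfile (w - m)) * (tailQuantile (w - m) + tailQuantile m) /
    (tailQuantile (w - m) - tailQuantile m)

theorem strictAntiOn_twoTailRatio {w : ℝ} (hw : w ≤ gaussTail 2) :
    StrictAntiOn (twoTailRatio w) (Ioo (w / 2) w) := by
  have h20 : gaussTail 2 < gaussTail 0 := strictAnti_gaussTail two_pos
  have hderiv : ∀ m ∈ Ioo (w / 2) w, ∃ d < 0, HasDerivAt (twoTailRatio w) d m := by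
    rintro m ⟨hm1, hm2⟩
    have hm0 : 0 < m := by linarith
    have hmt : m < gaussTail 0 := by linarith
    have hk0 : 0 < w - m := by linarith
    have hkt : w - m < gaussTail 0 := by linarith
    have hin : HasDerivAt (fun m => w - m) (-1) m := by
      simpa using (hasDerivAt_id m).const_sub w
    have hu := hasDerivAt_tailProfile hm0 hmt
    have hv : HasDerivAt (fun m => tailProfile (w - m)) _ m :=
      (hasDerivAt_tailProfile hk0 hkt).comp m hin
    have hx := hasDerivAt_tailQuantile hm0 hmt
    have hy : HasDerivAt (fun m => tailQuantile (w - m)) _ m :=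
      (hasDerivAt_tailQuantile hk0 hkt).comp m hin
    have hxy : tailQuantile m < tailQuantile (w - m) := tailQuantile_lt hk0 (by linarith) hmt
    -- The bound w ≤ T(2) serves to place both endpoints beyond 2.
    have h2x : 2 ≤ tailQuantile m := by
      rw [← strictAnti_gaussTail.le_iff_ge, gaussTail_tailQuantile hm0 hmt]
      linarith
    have hineq := profile_ratio_ineq h2x hxy
    rw [← tailProfile_of_pos hm0, ← tailProfile_of_pos hk0] at hineq
    refine ⟨_, ?_, ((hu.sub hv).mul (hy.add hx)).div (hy.sub hx) (sub_pos.2 hxy).ne'⟩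
    have hup : 0 < tailProfile m := by rw [tailProfile_of_pos hm0]; exact Real.exp_pos _
    have hvp : 0 < tailProfile (w - m) := by rw [tailProfile_of_pos hk0]; exact Real.exp_pos _
    refine div_neg_of_neg_of_pos ?_ (by have := sub_pos.2 hxy; positivity)
    simp only [Pi.sub_apply, Pi.add_apply, Pi.mul_apply]
    generalize tailProfile m = u at *
    generalize tailProfile (w - m) = v at *
    generalize tailQuantile m = x at *
    generalize tailQuantile (w - m) = y at *
    rw [div_eq_mul_inv y, div_eq_mul_inv x] at hineq
    nlinarith
  refine strictAntiOn_of_deriv_neg (convex_Ioo _ _) (fun m hm => ?_) fun m hm => ?_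
  · obtain ⟨d, -, hd⟩ := hderiv m hm
    exact hd.continuousAt.continuousWithinAt
  · rw [interior_Ioo] at hm
    obtain ⟨d, hd0, hd⟩ := hderiv m hm
    rwa [hd.deriv]

theorem hasDerivAt_twoTailEnergy {β w m : ℝ} (hw : w ≤ gaussTail 2) (hm : m ∈ Ioo (w / 2) w) :
    HasDerivAt (twoTailEnergy β w) ((tailQuantile (w - m) - tailQuantile m) *
      (2 * β * twoTailRatio w m - 1)) m := by
  have h20 : gaussTail 2 < gaussTail 0 := strictAnti_gaussTail two_pos
  obtain ⟨hm1, hm2⟩ := hm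
  have hm0 : 0 < m := by linarith
  have hmt : m < gaussTail 0 := by linarith
  have hk0 : 0 < w - m := by linarith
  have hkt : w - m < gaussTail 0 := by linarith
  have hin : HasDerivAt (fun m => w - m) (-1) m := by
    simpa using (hasDerivAt_id m).const_sub w
  have hu := hasDerivAt_tailProfile hm0 hmt
  have hv : HasDerivAt (fun m => tailProfile (w - m)) _ m :=
    (hasDerivAt_tailProfile hk0 hkt).comp m hin
  have hxy : tailQuantile m < tailQuantile (w - m) := tailQuantile_lt hk0 (by linarith) hmt
  refine ((hu.add hv).add (((hu.sub hv).pow 2).const_mul β)).congr_deriv ?_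
  have := (sub_pos.2 hxy).ne'
  rw [twoTailRatio]
  simp only [Pi.sub_apply]
  field_simp
  ring

theorem continuousOn_twoTailEnergy {β w : ℝ} (hw : w ≤ gaussTail 2) (hw0 : 0 < w) :
    ContinuousOn (twoTailEnergy β w) (Icc (w / 2) w) := by
  have h20 : gaussTail 2 < gaussTail 0 := strictAnti_gaussTail two_pos
  intro m hm
  have h1 : ContinuousAt tailProfile m := continuousAt_tailProfile (by linarith [hm.2])
  have h2 : ContinuousAt (fun m => tailProfile (w - m)) m :=
    ContinuousAt.comp (g := tailProfile) (continuousAt_tailProfile (by linarith [hm.1]))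
      (by fun_prop)
  exact ((h1.add h2).add (((h1.sub h2).pow 2).const_mul β)).continuousWithinAt

theorem twoTailEnergy_half (β w : ℝ) : twoTailEnergy β w (w / 2) = 2 * tailProfile (w / 2) := by
  rw [twoTailEnergy, sub_half]
  ring

theorem twoTailEnergy_self (β w : ℝ) :
    twoTailEnergy β w w = tailProfile w + β * tailProfile w ^ 2 := by
  rw [twoTailEnergy, sub_self, tailProfile_of_nonpos le_rfl]
  ring

/-- The derivative changes sign at most once, from plus to minus, so no interior point reaches the
minimum of the endpoint values. -/
theorem min_lt_twoTailEnergy {β w m : ℝ} (hβ : 0 ≤ β) (hw : w ≤ gaussTail 2)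
    (hm : m ∈ Ioo (w / 2) w) :
    min (twoTailEnergy β w w) (twoTailEnergy β w (w / 2)) < twoTailEnergy β w m := by
  have h20 : gaussTail 2 < gaussTail 0 := strictAnti_gaussTail two_pos
  have hw0 : 0 < w := by linarith [hm.1, hm.2]
  have hcont := continuousOn_twoTailEnergy (β := β) hw hw0
  have hq : ∀ k ∈ Ioo (w / 2) w, 0 < tailQuantile (w - k) - tailQuantile k := fun k hk =>
    sub_pos.2 (tailQuantile_lt (by linarith [hk.2]) (by linarith [hk.1]) (by linarith [hk.2]))
  -- If the derivative is nonnegative at `m`, it is positive on all of (w/2, m), so the strip is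
  -- strictly better. Otherwise it is negative on (m, w), and the half-line is.
  rcases le_or_gt 1 (2 * β * twoTailRatio w m) with h | h
  · have hβ0 : 0 < β := by
      rcases hβ.eq_or_lt with rfl | h'
      · norm_num at h
      · exact h'
    refine min_lt_of_right_lt ?_
    have hmono : StrictMonoOn (twoTailEnergy β w) (Icc (w / 2) m) := by
      refine strictMonoOn_of_deriv_pos (convex_Icc _ _)
        (hcont.mono (Icc_subset_Icc le_rfl hm.2.le)) fun k hk => ?_
      rw [interior_Icc] at hk
      have hk' : k ∈ Ioo (w / 2) w := ⟨hk.1, hk.2.trans hm.2⟩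
      rw [(hasDerivAt_twoTailEnergy hw hk').deriv]
      have := strictAntiOn_twoTailRatio hw hk' hm hk.2
      refine mul_pos (hq k hk') ?_
      have : 2 * β * twoTailRatio w m < 2 * β * twoTailRatio w k := by gcongr
      linarith
    exact hmono (left_mem_Icc.2 hm.1.le) (right_mem_Icc.2 hm.1.le) hm.1
  · refine min_lt_of_left_lt ?_
    have hanti : StrictAntiOn (twoTailEnergy β w) (Icc m w) := by
      refine strictAntiOn_of_deriv_neg (convex_Icc _ _)
        (hcont.mono (Icc_subset_Icc hm.1.le le_rfl)) fun k hk => ?_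
      rw [interior_Icc] at hk
      have hk' : k ∈ Ioo (w / 2) w := ⟨hm.1.trans hk.1, hk.2⟩
      rw [(hasDerivAt_twoTailEnergy hw hk').deriv]
      have := strictAntiOn_twoTailRatio hw hm hk' hk.1
      refine mul_neg_of_pos_of_neg (hq k hk') ?_
      have : 2 * β * twoTailRatio w k ≤ 2 * β * twoTailRatio w m := by gcongr
      linarith
    exact hanti (left_mem_Icc.2 hm.2.le) (right_mem_Icc.2 hm.2.le) hm.2

/-! ### The penalized problem for two masses -/

/-- By Mills' bound (s + 1) T(s) is about (1 + 1/s) exp(-s²/2). The gain 1/s beats both 7 / (10 s²)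
and the contribution of T(s + 1/2), which carries a factor e^(-s/2). Consequently the penalty alone
exceeds V when both masses are at most T(s + 1/2). -/
theorem gaussTail_gap {s : ℝ} (hs : 100 ≤ s) :
    (1 + 7 / 10 / s ^ 2) * Real.exp (-s ^ 2 / 2) <
      (s + 1) * (gaussTail s - 2 * gaussTail (s + 1 / 2)) := by
  have h1 := le_gaussTail s
  have h2 : gaussTail (s + 1 / 2) ≤ Real.exp (-s ^ 2 / 2) * (48 / s ^ 3 / s) := by
    refine (gaussTail_le (by linarith)).trans ?_
    rw [← mul_div_assoc]
    have h3 : Real.exp (-(s + 1 / 2) ^ 2 / 2) ≤ Real.exp (-s ^ 2 / 2) * Real.exp (-(s / 2)) := by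
      rw [← Real.exp_add, Real.exp_le_exp]
      nlinarith
    -- The cubic term of the exponential series: (s/2)³ / 3! = s³ / 48.
    have h4 : Real.exp (-(s / 2)) ≤ 48 / s ^ 3 := by
      rw [Real.exp_neg, inv_le_comm₀ (Real.exp_pos _) (by positivity)]
      have := Real.pow_div_factorial_le_exp (s / 2) (by linarith) 3
      refine le_trans (le_of_eq ?_) this
      have : s ≠ 0 := by linarith
      simp [Nat.factorial]
      field_simp
      norm_num
    gcongr
    · exact h3.trans (by gcongr)
    · linarith
  have hS := Real.exp_pos (-s ^ 2 / 2)
  generalize Real.exp (-s ^ 2 / 2) = S at *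
  have h5 : (1 + 7 / 10 / s ^ 2) < (s + 1) * (s / (s ^ 2 + 1) - 2 * (48 / s ^ 3 / s)) := by
    have hs0 : 0 < s := by linarith
    rw [← sub_pos]
    have : (s + 1) * (s / (s ^ 2 + 1) - 2 * (48 / s ^ 3 / s)) - (1 + 7 / 10 / s ^ 2) =
        (10 * s ^ 5 - 17 * s ^ 4 - 960 * s ^ 3 - 967 * s ^ 2 - 960 * s - 960)
          / (10 * s ^ 4 * (s ^ 2 + 1)) := by
      field_simp
      ring
    rw [this]
    apply div_pos _ (by positivity)
    obtain ⟨t, rfl⟩ : ∃ t, s = t + 100 := ⟨s - 100, by ring⟩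
    have ht : 0 ≤ t := by linarith
    ring_nf
    positivity
  calc (1 + 7 / 10 / s ^ 2) * S < (s + 1) * (s / (s ^ 2 + 1) - 2 * (48 / s ^ 3 / s)) * S := by
        gcongr
    _ = (s + 1) * (s / (s ^ 2 + 1) * S - 2 * (S * (48 / s ^ 3 / s))) := by ring
    _ ≤ _ := by
        have : 0 ≤ s + 1 := by linarith
        gcongr

/-- The energy of two half-lines with masses `m` and `k`, with a penalty on the total mass. -/
noncomputable def penalizedTailEnergy (β s m k : ℝ) : ℝ :=
  tailProfile m + tailProfile k + β * (tailProfile m - tailProfile k) ^ 2 +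
    (s + 1) * |m + k - gaussTail s|

theorem penalizedTailEnergy_comm (β s m k : ℝ) :
    penalizedTailEnergy β s m k = penalizedTailEnergy β s k m := by
  rw [penalizedTailEnergy, penalizedTailEnergy, add_comm m k]
  ring

/-- The smallest energy among the half-line and the symmetric strip. -/
noncomputable def minTailEnergy (β s : ℝ) : ℝ :=
  min (Real.exp (-s ^ 2 / 2) + β * Real.exp (-s ^ 2 / 2) ^ 2)
    (2 * tailProfile (gaussTail s / 2))

/-- Whenever the total mass is not w, correcting the larger mass `m` to w - k, or passing to the
strip, strictly lowers the energy, except when both masses are so small that the penalty alone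
exceeds V. On m + k = w the one-variable analysis applies. -/
theorem penalizedTailEnergy_cases_of_le {β s m k : ℝ} (hs : 100 ≤ s) (hβ : 0 ≤ β)
    (hβs : β * Real.exp (-s ^ 2 / 2) ≤ 7 / 10 / s ^ 2) (hk : 0 ≤ k) (hkm : k ≤ m)
    (hm : m < gaussTail 0) :
    minTailEnergy β s < penalizedTailEnergy β s m k ∨ (m = gaussTail s ∧ k = 0) ∨
      (m = gaussTail s / 2 ∧ k = gaussTail s / 2) := by
  have hs0 : 0 < s := by linarith
  have hw2 : gaussTail s ≤ gaussTail 2 := strictAnti_gaussTail.antitone (by linarith)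
  have h20 : gaussTail 2 < gaussTail 0 := strictAnti_gaussTail two_pos
  have hw0 := gaussTail_pos s
  have hUw : tailProfile (gaussTail s) = Real.exp (-s ^ 2 / 2) := tailProfile_gaussTail hs0
  have hmin : minTailEnergy β s =
      min (twoTailEnergy β (gaussTail s) (gaussTail s))
        (twoTailEnergy β (gaussTail s) (gaussTail s / 2)) := by
    rw [minTailEnergy, twoTailEnergy_self, twoTailEnergy_half, hUw]
  have hcurve : ∀ l ∈ Icc (gaussTail s / 2) (gaussTail s),
      minTailEnergy β s ≤ twoTailEnergy β (gaussTail s) l := by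
    intro l hl
    rw [hmin]
    rcases hl.1.eq_or_lt with rfl | h1
    · exact min_le_right _ _
    rcases hl.2.eq_or_lt with rfl | h2
    · exact min_le_left _ _
    exact (min_lt_twoTailEnergy hβ hw2 ⟨h1, h2⟩).le
  rcases lt_trichotomy (m + k) (gaussTail s) with hlt | heq | hgt
  · left
    have habs : |m + k - gaussTail s| = gaussTail s - m - k := by
      rw [abs_of_neg (by linarith)]; ring
    by_cases hcase : m ≤ gaussTail (s + 1 / 2)
    · have h1 : minTailEnergy β s ≤ (1 + 7 / 10 / s ^ 2) * Real.exp (-s ^ 2 / 2) := by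
        refine (min_le_left _ _).trans ?_
        have := mul_le_mul_of_nonneg_right hβs (Real.exp_pos (-s ^ 2 / 2)).le
        nlinarith
      refine h1.trans_lt ((gaussTail_gap hs).trans_le ?_)
      rw [penalizedTailEnergy, habs]
      have h2 : (s + 1) * (gaussTail s - 2 * gaussTail (s + 1 / 2)) ≤
          (s + 1) * (gaussTail s - m - k) := by
        apply mul_le_mul_of_nonneg_left _ (by linarith)
        linarith
      have := tailProfile_nonneg m
      have := tailProfile_nonneg k
      have : 0 ≤ β * (tailProfile m - tailProfile k) ^ 2 := by positivity
      linarith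
    · push Not at hcase
      have hm0 : 0 < m := (gaussTail_pos _).trans hcase
      have hq : tailQuantile m < s + 1 / 2 := by
        rwa [← strictAnti_gaussTail.lt_iff_gt, gaussTail_tailQuantile hm0 hm]
      -- Enlarge `m` to w - k. By concavity the profile grows at slope at most `tailQuantile m` < s
      -- + 1/2, and the barycenter term adds only the relative amount 14 / (10 s²). This stays below
      -- the slope s + 1 of the saved penalty.
      refine (hcurve (gaussTail s - k) ⟨by linarith, by linarith⟩).trans_lt ?_
      have hsub := tailProfile_sub_le hm0 (by linarith : m < gaussTail s - k) (by linarith)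
      have hv := tailProfile_le hk hkm hm
      have hv0 := tailProfile_nonneg k
      have hu' : tailProfile (gaussTail s - k) ≤ Real.exp (-s ^ 2 / 2) := by
        rw [← hUw]
        exact tailProfile_le (by linarith) (by linarith) (by linarith)
      have huu := tailProfile_lt hm0.le (by linarith : m < gaussTail s - k) (by linarith)
      rw [twoTailEnergy, penalizedTailEnergy, habs, sub_sub_cancel]
      set δ := gaussTail s - m - k with hδ
      have hδ0 : 0 < δ := by linarith
      have hδ' : gaussTail s - k - m = δ := by rw [hδ]; ring
      rw [hδ'] at hsub
      generalize tailProfile m = u at *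
      generalize tailProfile k = v at *
      generalize tailProfile (gaussTail s - k) = u' at *
      generalize Real.exp (-s ^ 2 / 2) = S at *
      have h3 : β * (u' - v) ^ 2 - β * (u - v) ^ 2 ≤ (u' - u) * (14 / 10 / s ^ 2) := by
        have e : β * (u' - v) ^ 2 - β * (u - v) ^ 2 = (u' - u) * (β * (u' + u - 2 * v)) := by ring
        rw [e]
        apply mul_le_mul_of_nonneg_left _ (by linarith)
        have : β * (u' + u - 2 * v) ≤ β * (2 * S) := by
          apply mul_le_mul_of_nonneg_left _ hβ; linarith
        have e2 : (14 : ℝ) / 10 / s ^ 2 = 2 * (7 / 10 / s ^ 2) := by ring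
        linarith
      have h4 : (14 : ℝ) / 10 / s ^ 2 ≤ 14 / 10 / (100 * s) := by
        apply div_le_div_of_nonneg_left (by norm_num) (by positivity)
        nlinarith
      have h5 : (u' - u) * (1 + 14 / 10 / s ^ 2) < (s + 1) * δ := by
        calc (u' - u) * (1 + 14 / 10 / s ^ 2)
            ≤ (tailQuantile m * δ) * (1 + 14 / 10 / (100 * s)) := by
              apply mul_le_mul hsub (by linarith) (by positivity)
              linarith
          _ ≤ ((s + 1 / 2) * δ) * (1 + 14 / 10 / (100 * s)) := by gcongr
          _ = ((s + 1 / 2) * (1 + 14 / 10 / (100 * s))) * δ := by ring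
          _ < (s + 1) * δ := by
              apply mul_lt_mul_of_pos_right _ hδ0
              have e : (s + 1 / 2) * (1 + 14 / 10 / (100 * s)) =
                  s + 1 / 2 + 14 / 1000 + 7 / 1000 / s := by
                field_simp
                ring
              have : 7 / 1000 / s ≤ 7 / 1000 / 100 := by gcongr
              linarith
      nlinarith
  · have hk' : k = gaussTail s - m := by linarith
    rcases hkm.eq_or_lt with h | h
    · right; right
      constructor <;> linarith
    rcases hk.eq_or_lt with h0 | h0
    · right; left
      exact ⟨by linarith, h0.symm⟩
    left
    rw [hmin]
    refine (min_lt_twoTailEnergy (m := m) hβ hw2 ⟨by linarith, by linarith⟩).trans_eq ?_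
    rw [twoTailEnergy, penalizedTailEnergy, hk']
    simp
  · left
    have hpen : 0 < (s + 1) * |m + k - gaussTail s| := by
      have := abs_pos.2 (by linarith : m + k - gaussTail s ≠ 0)
      positivity
    -- With too much mass, either both masses are at least w/2 and the strip is cheaper, or
    -- shrinking `m` to w - k ≥ k lowers the profile and the barycenter term without making the
    -- latter's difference negative.
    rcases le_or_gt (gaussTail s / 2) k with h | h
    · refine (min_le_right _ _).trans_lt ?_
      have h1 := tailProfile_le (by linarith) h (by linarith)
      have h2 := tailProfile_le (by linarith) (h.trans hkm) hm
      have : 0 ≤ β * (tailProfile m - tailProfile k) ^ 2 := by positivity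
      rw [penalizedTailEnergy]
      linarith
    · refine (hcurve (gaussTail s - k) ⟨by linarith, by linarith⟩).trans_lt ?_
      rw [twoTailEnergy, penalizedTailEnergy, sub_sub_cancel]
      have h1 := tailProfile_le (by linarith) (by linarith : gaussTail s - k ≤ m) hm
      have h2 := tailProfile_le hk (by linarith : k ≤ gaussTail s - k) (by linarith)
      have : β * (tailProfile (gaussTail s - k) - tailProfile k) ^ 2 ≤
          β * (tailProfile m - tailProfile k) ^ 2 := by
        apply mul_le_mul_of_nonneg_left _ hβ
        apply pow_le_pow_left₀ <;> linarith
      linarith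

theorem penalizedTailEnergy_cases {β s m k : ℝ} (hs : 100 ≤ s) (hβ : 0 ≤ β)
    (hβs : β * Real.exp (-s ^ 2 / 2) ≤ 7 / 10 / s ^ 2) (hk : 0 ≤ k) (hm : 0 ≤ m)
    (hk1 : k < gaussTail 0) (hm1 : m < gaussTail 0) :
    minTailEnergy β s < penalizedTailEnergy β s m k ∨ (m = gaussTail s ∧ k = 0) ∨
      (m = 0 ∧ k = gaussTail s) ∨ (m = gaussTail s / 2 ∧ k = gaussTail s / 2) := by
  rcases le_total k m with h | h
  · rcases penalizedTailEnergy_cases_of_le hs hβ hβs hk h hm1 with h | h | h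
    · exact Or.inl h
    · exact Or.inr (Or.inl h)
    · exact Or.inr (Or.inr (Or.inr h))
  · rw [penalizedTailEnergy_comm]
    rcases penalizedTailEnergy_cases_of_le hs hβ hβs hm h hk1 with h | h | h
    · exact Or.inl h
    · exact Or.inr (Or.inr (Or.inl h.symm))
    · exact Or.inr (Or.inr (Or.inr h.symm))

theorem minTailEnergy_le {β s m k : ℝ} (hs : 100 ≤ s) (hβ : 0 ≤ β)
    (hβs : β * Real.exp (-s ^ 2 / 2) ≤ 7 / 10 / s ^ 2) (hk : 0 ≤ k) (hm : 0 ≤ m)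
    (hk1 : k < gaussTail 0) (hm1 : m < gaussTail 0) :
    minTailEnergy β s ≤ penalizedTailEnergy β s m k := by
  have hU := tailProfile_gaussTail (by linarith : 0 < s)
  have hU0 := tailProfile_of_nonpos le_rfl
  rcases penalizedTailEnergy_cases hs hβ hβs hk hm hk1 hm1 with h | ⟨rfl, rfl⟩ | ⟨rfl, rfl⟩ |
    ⟨rfl, rfl⟩
  · exact h.le
  · refine (min_le_left _ _).trans_eq ?_
    rw [penalizedTailEnergy, hU, hU0]
    simp
  · refine (min_le_left _ _).trans_eq ?_
    rw [penalizedTailEnergy, hU, hU0]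
    simp
  · refine (min_le_right _ _).trans_eq ?_
    rw [penalizedTailEnergy]
    simp
    ring

/-! ### Replacing one side of the complement by a half-line -/

/-- The half-line `(x, ∞)`, `x ≥ 0`, with unnormalized Gaussian mass `m`. -/
def halfTail (m : ℝ) : Set ℝ := {x | 0 < x ∧ gaussTail x < m}

theorem halfTail_zero : halfTail 0 = ∅ :=
  eq_empty_of_forall_notMem fun x hx => (gaussTail_nonneg x).not_gt hx.2

theorem halfTail_gaussTail {x : ℝ} (hx : 0 ≤ x) : halfTail (gaussTail x) = Ioi x := by
  ext y
  rw [halfTail, mem_ofPred_eq, strictAnti_gaussTail.lt_iff_gt, mem_Ioi]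
  exact ⟨fun h => h.2, fun h => ⟨hx.trans_lt h, h⟩⟩

theorem mul_setIntegral_le {D : Set ℝ} (hD : MeasurableSet D) {c : ℝ} (hDc : D ⊆ Ioi c) :
    c * ∫ t in D, Real.exp (-t ^ 2 / 2) ≤ ∫ t in D, t * Real.exp (-t ^ 2 / 2) := by
  rw [← integral_const_mul]
  refine setIntegral_mono_on (integrable_exp_neg_sq_half.integrableOn.const_mul _)
    integrable_mul_exp_neg_sq_half.integrableOn hD fun t ht => ?_
  exact mul_le_mul_of_nonneg_right (mem_Ioi.1 (hDc ht)).le (Real.exp_pos _).le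

theorem mul_gaussTail_sub_le {x y : ℝ} (hxy : x ≤ y) :
    x * (gaussTail x - gaussTail y) ≤ Real.exp (-x ^ 2 / 2) - Real.exp (-y ^ 2 / 2) := by
  have h := mul_setIntegral_le (D := Ioi x \ Ioi y) (measurableSet_Ioi.diff measurableSet_Ioi)
    sdiff_subset
  rwa [setIntegral_sdiff measurableSet_Ioi integrable_exp_neg_sq_half.integrableOn
    (Ioi_subset_Ioi hxy), setIntegral_sdiff measurableSet_Ioi
    integrable_mul_exp_neg_sq_half.integrableOn (Ioi_subset_Ioi hxy),
    integral_Ioi_mul_exp_neg_sq_half, integral_Ioi_mul_exp_neg_sq_half] at h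

theorem notMem_essBoundary_of_conull {E U : Set ℝ} (hU : IsOpen U) (h : volume (U \ E) = 0) {x : ℝ}
    (hx : x ∈ U) : x ∉ essBoundary E := by
  intro hxE
  obtain ⟨r, hr, hball⟩ := Metric.isOpen_iff.1 hU x hx
  exact (hxE r hr).2 (measure_mono_null (sdiff_subset_sdiff_left hball) h)

theorem next_essBoundary {E : Set ℝ} (hfin : ∀ a b, (essBoundary E ∩ Icc a b).Finite) (c : ℝ) :
    (∀ x ∈ Ioi c, x ∉ essBoundary E) ∨
      ∃ y > c, y ∈ essBoundary E ∧ ∀ x ∈ Ioo c y, x ∉ essBoundary E := by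
  by_cases h : ∀ x ∈ Ioi c, x ∉ essBoundary E
  · exact Or.inl h
  right
  push Not at h
  obtain ⟨z, hz, hzE⟩ := h
  have hf : (essBoundary E ∩ Ioc c z).Finite :=
    (hfin c z).subset (inter_subset_inter_right _ Ioc_subset_Icc_self)
  obtain ⟨y, hy, hmin⟩ := exists_min_image _ id hf ⟨z, hzE, hz, le_rfl⟩
  refine ⟨y, hy.2.1, hy.1, fun x hx hxE => ?_⟩
  exact (hmin x ⟨hxE, hx.1, hx.2.le.trans hy.2.2⟩).not_gt hx.2

/-- Propagates fullness from the non-null piece `V` to all of `U`. -/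
theorem conull_of_null_or_conull {E U V : Set ℝ} (hVU : V ⊆ U) (hV : volume (V \ E) = 0)
    (hV0 : volume V ≠ 0) (h : volume (U ∩ E) = 0 ∨ volume (U \ E) = 0) : volume (U \ E) = 0 := by
  refine h.resolve_left fun h0 => hV0 (measure_mono_null ?_ (measure_union_null hV h0))
  intro x hx
  by_cases hxE : x ∈ E
  · exact Or.inr ⟨hVU hx, hxE⟩
  · exact Or.inl ⟨hx, hxE⟩

/-- The part of the complement of `E` on the right of an interval filled by `E`, compared with the
half-line of the same barycenter. The excess `d` is paid for by the boundary points in `A`. -/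
theorem exists_right_halfTail {E : Set ℝ} (hE : MeasurableSet E)
    (hfin : ∀ a b, (essBoundary E ∩ Icc a b).Finite) {x₀ : ℝ} (hx₀ : 0 < x₀)
    (hfull : volume (Ioo (-x₀) x₀ \ E) = 0) :
    ∃ (A : Finset ℝ) (m d : ℝ), (∀ x ∈ A, 0 < x ∧ x ∈ essBoundary E) ∧ 0 ≤ m ∧
      m ≤ gaussTail x₀ ∧ 0 ≤ d ∧ ∫ t in Ioi 0 \ E, t * Real.exp (-t ^ 2 / 2) = tailProfile m ∧
      tailProfile m + 2 * d ≤ ∑ x ∈ A, Real.exp (-x ^ 2 / 2) ∧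
      |(∫ t in Ioi 0 \ E, Real.exp (-t ^ 2 / 2)) - m| ≤ d / x₀ ∧
      (d = 0 → (Ioi 0 \ E : Set ℝ) =ᵐ[volume] halfTail m) := by
  have hvol : volume (Ioo (-x₀) x₀) ≠ 0 := by
    rw [Real.volume_Ioo]
    exact (ENNReal.ofReal_pos.2 (by linarith)).ne'
  rcases next_essBoundary hfin 0 with hno | ⟨x₁, hx₁, hx₁E, hx₁min⟩
  · have hconst := null_or_conull_of_disjoint_essBoundary (E := E) (U := Ioi (-x₀))
      isPreconnected_Ioi fun x hx => by
        rcases le_or_gt x 0 with h | h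
        · exact notMem_essBoundary_of_conull isOpen_Ioo hfull ⟨hx, by linarith⟩
        · exact hno x h
    have hnull : volume (Ioi 0 \ E) = 0 := measure_mono_null
      (sdiff_subset_sdiff_left (Ioi_subset_Ioi (by linarith)))
      (conull_of_null_or_conull Ioo_subset_Ioi_self hfull hvol hconst)
    refine ⟨∅, 0, 0, by simp, le_rfl, gaussTail_nonneg _, le_rfl, ?_, ?_, ?_, fun _ => ?_⟩
    · rw [setIntegral_measure_zero _ hnull, tailProfile_of_nonpos le_rfl]
    · simp [tailProfile_of_nonpos]
    · rw [setIntegral_measure_zero _ hnull]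
      simp
    · rw [halfTail_zero]
      exact ae_eq_empty.2 hnull
  have hx₀₁ : x₀ ≤ x₁ := by
    by_contra! h
    exact notMem_essBoundary_of_conull isOpen_Ioo hfull ⟨by linarith, h⟩ hx₁E
  have hleft : volume (Ioo (-x₀) x₁ \ E) = 0 := by
    refine conull_of_null_or_conull (Ioo_subset_Ioo le_rfl hx₀₁) hfull hvol
      (null_or_conull_of_disjoint_essBoundary isPreconnected_Ioo fun x hx => ?_)
    rcases le_or_gt x 0 with h | h
    · exact notMem_essBoundary_of_conull isOpen_Ioo hfull ⟨hx.1, by linarith⟩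
    · exact hx₁min x ⟨h, hx.2⟩
  have hright : ∀ V : Set ℝ, IsPreconnected V → (∀ x ∈ V, x ∉ essBoundary E) →
      (∃ r > 0, Ioo x₁ (x₁ + r) ⊆ V) → volume (V ∩ E) = 0 := by
    rintro V hV hVE ⟨r, hr, hrV⟩
    refine (null_or_conull_of_disjoint_essBoundary hV hVE).resolve_right fun h0 => ?_
    -- Capping the radius at x₁ keeps the ball in (0, ∞), where `E` is full to the left of x₁. If
    -- `E` were also full just to the right, x₁ would not be an essential boundary point.
    refine (hx₁E (min r x₁) (lt_min hr hx₁)).2 (measure_mono_null ?_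
      (measure_union_null hleft (measure_union_null h0 (measure_singleton x₁))))
    rintro y ⟨hy, hyE⟩
    rw [Real.ball_eq_Ioo] at hy
    have h1 := min_le_left r x₁
    have h2 := min_le_right r x₁
    rcases lt_trichotomy y x₁ with h | h | h
    · exact Or.inl ⟨⟨by linarith [hy.1], h⟩, hyE⟩
    · exact Or.inr (Or.inr h)
    · exact Or.inr (Or.inl ⟨hrV ⟨h, by linarith [hy.2]⟩, hyE⟩)
  set D : Set ℝ := Ioi x₁ ∩ E with hD
  have hDm : MeasurableSet D := measurableSet_Ioi.inter hE
  have hDsub : D ⊆ Ioi x₁ := inter_subset_left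
  set d : ℝ := ∫ t in D, t * Real.exp (-t ^ 2 / 2) with hd
  have hpos : ∀ S : Set ℝ, MeasurableSet S → S ⊆ Ioi 0 →
      0 ≤ ∫ t in S, t * Real.exp (-t ^ 2 / 2) := fun S hS hS0 =>
    setIntegral_nonneg hS fun t ht => mul_nonneg (mem_Ioi.1 (hS0 ht)).le (Real.exp_pos _).le
  have hd0 : 0 ≤ d := hpos D hDm (hDsub.trans (Ioi_subset_Ioi hx₁.le))
  -- Just beyond x₁ the set `E` is null, so `D` lies beyond the next boundary point `y`. The
  -- perimeter at `y` equals the first moment of (y, ∞), which bounds `d`.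
  obtain ⟨A, hA, hAsum⟩ : ∃ A : Finset ℝ, (∀ x ∈ A, 0 < x ∧ x ∈ essBoundary E) ∧
      Real.exp (-x₁ ^ 2 / 2) + d ≤ ∑ x ∈ A, Real.exp (-x ^ 2 / 2) := by
    rcases next_essBoundary hfin x₁ with hno | ⟨y, hy, hyE, hymin⟩
    · refine ⟨{x₁}, by simpa using ⟨hx₁, hx₁E⟩, ?_⟩
      have h0 := hright (Ioi x₁) isPreconnected_Ioi hno ⟨1, one_pos, Ioo_subset_Ioi_self⟩
      rw [hd, setIntegral_measure_zero _ h0]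
      simp
    · refine ⟨{x₁, y}, ?_, ?_⟩
      · intro x hx
        rcases Finset.mem_insert.1 hx with rfl | hx
        · exact ⟨hx₁, hx₁E⟩
        · rw [Finset.mem_singleton.1 hx]
          exact ⟨hx₁.trans hy, hyE⟩
      · rw [Finset.sum_pair (ne_of_lt hy)]
        gcongr
        have h0 := hright (Ioo x₁ y) isPreconnected_Ioo hymin
          ⟨y - x₁, sub_pos.2 hy, by rw [add_sub_cancel]⟩
        rw [← integral_Ioi_mul_exp_neg_sq_half y, hd]
        refine setIntegral_mono_set integrable_mul_exp_neg_sq_half.integrableOn ?_ ?_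
        · filter_upwards [ae_restrict_mem measurableSet_Ioi] with t ht
          exact mul_nonneg ((hx₁.trans hy).trans ht).le (Real.exp_pos _).le
        · have h0' : volume (D \ Ioi y) = 0 := by
            refine measure_mono_null ?_ (measure_union_null h0 (measure_singleton y))
            rintro t ⟨⟨ht, htE⟩, hty⟩
            rcases (not_lt.1 (mem_Ioi.not.1 hty)).eq_or_lt with h | h
            · exact Or.inr h
            · exact Or.inl ⟨⟨ht, h⟩, htE⟩
          exact ae_le_set.2 h0'
  have hC : (Ioi 0 \ E : Set ℝ) =ᵐ[volume] (Ioi x₁ \ D : Set ℝ) := by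
    rw [ae_eq_set]
    constructor
    · refine measure_mono_null ?_ (measure_union_null hleft (measure_singleton x₁))
      rintro t ⟨⟨ht, htE⟩, htD⟩
      rcases lt_trichotomy t x₁ with h | h | h
      · exact Or.inl ⟨⟨by linarith [mem_Ioi.1 ht], h⟩, htE⟩
      · exact Or.inr h
      · exact absurd ⟨h, fun h' => htE h'.2⟩ htD
    · rw [sdiff_eq_empty.2, measure_empty]
      exact fun t ht => ⟨hx₁.trans ht.1, fun htE => ht.2 ⟨ht.1, htE⟩⟩
  have hb : ∫ t in Ioi 0 \ E, t * Real.exp (-t ^ 2 / 2) = Real.exp (-x₁ ^ 2 / 2) - d := by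
    rw [setIntegral_congr_set hC, setIntegral_sdiff hDm integrable_mul_exp_neg_sq_half.integrableOn
      hDsub, integral_Ioi_mul_exp_neg_sq_half]
  have hn : ∫ t in Ioi 0 \ E, Real.exp (-t ^ 2 / 2) =
      gaussTail x₁ - ∫ t in D, Real.exp (-t ^ 2 / 2) := by
    rw [setIntegral_congr_set hC, setIntegral_sdiff hDm integrable_exp_neg_sq_half.integrableOn
      hDsub, gaussTail]
  have hn0 : 0 ≤ ∫ t in D, Real.exp (-t ^ 2 / 2) := integral_nonneg fun _ => (Real.exp_pos _).le
  have hnd : ∫ t in D, Real.exp (-t ^ 2 / 2) ≤ d / x₁ := by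
    rw [le_div_iff₀ hx₁, mul_comm]
    exact mul_setIntegral_le hDm hDsub
  have hu0 : 0 ≤ Real.exp (-x₁ ^ 2 / 2) - d := by
    rw [← hb]
    exact hpos _ (measurableSet_Ioi.diff hE) sdiff_subset
  have hdx : d / x₁ ≤ d / x₀ := div_le_div_of_nonneg_left hd0 hx₀ hx₀₁
  -- Solve for the half-line of first moment exp(-x₁²/2) - d, using mass 0 if this vanishes. Both
  -- `m` and the true mass lie between T(x₁) - d/x₁ and T(x₁), so they differ by at most d/x₁.
  obtain ⟨m, hm0, hm1, hmu, hmd, hmeq⟩ : ∃ m, 0 ≤ m ∧ m ≤ gaussTail x₁ ∧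
      tailProfile m = Real.exp (-x₁ ^ 2 / 2) - d ∧ gaussTail x₁ - m ≤ d / x₁ ∧
      (d = 0 → m = gaussTail x₁) := by
    rcases hu0.eq_or_lt with h | h
    · refine ⟨0, le_rfl, gaussTail_nonneg _, by rw [tailProfile_of_nonpos le_rfl, h], ?_, ?_⟩
      · rw [sub_zero, ← sub_eq_zero.1 h.symm]
        exact gaussTail_le hx₁
      · intro h'
        rw [h', sub_zero] at h
        exact absurd h (Real.exp_pos _).ne
    · have hlog : Real.log (Real.exp (-x₁ ^ 2 / 2) - d) ≤ -x₁ ^ 2 / 2 := by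
        rw [Real.log_le_iff_le_exp h]
        linarith
      have hsq : √(-2 * Real.log (Real.exp (-x₁ ^ 2 / 2) - d)) ^ 2 =
          -2 * Real.log (Real.exp (-x₁ ^ 2 / 2) - d) :=
        Real.sq_sqrt (by nlinarith [sq_nonneg x₁])
      have hexp : Real.exp (-√(-2 * Real.log (Real.exp (-x₁ ^ 2 / 2) - d)) ^ 2 / 2) =
          Real.exp (-x₁ ^ 2 / 2) - d := by
        rw [hsq, show -(-2 * Real.log (Real.exp (-x₁ ^ 2 / 2) - d)) / 2 =
          Real.log (Real.exp (-x₁ ^ 2 / 2) - d) by ring, Real.exp_log h]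
      set z := √(-2 * Real.log (Real.exp (-x₁ ^ 2 / 2) - d)) with hz
      have hz0 : 0 ≤ z := Real.sqrt_nonneg _
      have hxz : x₁ ≤ z := (exp_neg_sq_half_le_iff hz0 hx₁.le).1 (by linarith)
      refine ⟨gaussTail z, gaussTail_nonneg _, strictAnti_gaussTail.antitone hxz, ?_, ?_, ?_⟩
      · rw [tailProfile_gaussTail (hx₁.trans_le hxz), hexp]
      · rw [le_div_iff₀ hx₁, mul_comm]
        have := mul_gaussTail_sub_le hxz
        linarith
      · intro h'
        rw [le_antisymm ((exp_neg_sq_half_le_iff hx₁.le hz0).1 (by linarith)) hxz]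
  refine ⟨A, m, d, hA, hm0, hm1.trans (strictAnti_gaussTail.antitone hx₀₁), hd0, by rw [hb, hmu],
    by linarith, ?_, fun h => ?_⟩
  · rw [hn, abs_le]
    constructor <;> linarith
  · rw [hmeq h, halfTail_gaussTail hx₁.le]
    refine hC.trans ?_
    have hDnull : volume D = 0 := by
      have hnn : 0 ≤ᵐ[volume.restrict D] fun t => t * Real.exp (-t ^ 2 / 2) := by
        filter_upwards [ae_restrict_mem hDm] with t ht
        exact mul_nonneg (hx₁.trans (hDsub ht)).le (Real.exp_pos _).le
      have h0 := (setIntegral_eq_zero_iff_of_nonneg_ae hnn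
        integrable_mul_exp_neg_sq_half.integrableOn).1 h
      rw [EventuallyEq, ae_restrict_iff' hDm] at h0
      refine measure_eq_zero_iff_ae_notMem.2 ?_
      filter_upwards [h0] with t ht htD
      have := ht htD
      have h1 : 0 < t * Real.exp (-t ^ 2 / 2) :=
        mul_pos (hx₁.trans (hDsub htD)) (Real.exp_pos _)
      exact h1.ne' this
    rw [ae_eq_set]
    refine ⟨by rw [sdiff_eq_empty.2 sdiff_subset, measure_empty], measure_mono_null ?_ hDnull⟩
    rintro t ⟨ht, htD⟩
    by_contra h'
    exact htD ⟨ht, h'⟩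

/-! ### Mass and barycenter through the two halves of the complement -/

theorem essBoundary_preimage_neg (E : Set ℝ) {x : ℝ} (hx : x ∈ essBoundary (Neg.neg ⁻¹' E)) :
    -x ∈ essBoundary E := by
  intro r hr
  have hball : Neg.neg ⁻¹' Metric.ball (-x) r = Metric.ball x r := by
    ext y
    simp only [mem_preimage, Metric.mem_ball, dist_neg_neg]
  have key : ∀ S : Set ℝ, volume (Neg.neg ⁻¹' S) = volume S := fun S =>
    Measure.measure_preimage_neg volume S
  refine ⟨?_, ?_⟩
  · rw [← key, preimage_inter, hball]
    exact (hx r hr).1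
  · rw [← key, preimage_sdiff, hball]
    exact (hx r hr).2

theorem integral_exp_neg_sq_half : ∫ t : ℝ, Real.exp (-t ^ 2 / 2) = √(2 * Real.pi) := by
  have h := integral_gaussian (1 / 2)
  rw [show Real.pi / (1 / 2) = 2 * Real.pi by ring] at h
  rw [← h]
  refine integral_congr_ae (Eventually.of_forall fun t => ?_)
  ring_nf

theorem integral_mul_exp_neg_sq_half : ∫ t : ℝ, t * Real.exp (-t ^ 2 / 2) = 0 :=
  integral_eq_zero_of_hasDerivAt_of_integrable (f := fun t => -Real.exp (-t ^ 2 / 2))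
    (fun t => (hasDerivAt_exp_neg_sq_half t).neg.congr_deriv (by ring))
    integrable_mul_exp_neg_sq_half integrable_exp_neg_sq_half.neg

/-- The integral over a set, in terms of the two halves of its complement. -/
theorem setIntegral_eq_sub_halves {f : ℝ → ℝ} (hf : Integrable f) {E : Set ℝ}
    (hE : MeasurableSet E) :
    ∫ t in E, f t = (∫ t, f t) - (∫ t in Ioi 0 \ E, f t) -
      ∫ t in Ioi 0 \ (Neg.neg ⁻¹' E), f (-t) := by
  have h1 : ∫ t in Ioi 0 \ (Neg.neg ⁻¹' E), f (-t) = ∫ t in Iio 0 \ E, f t := by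
    rw [← (Measure.measurePreserving_neg volume).setIntegral_preimage_emb
      (MeasurableEquiv.neg ℝ).measurableEmbedding f]
    congr 2
    ext t
    simp
  have h2 : (Eᶜ : Set ℝ) =ᵐ[volume] ((Ioi 0 \ E) ∪ (Iio 0 \ E) : Set ℝ) := by
    have h0 : ∀ᵐ t : ℝ, t ≠ 0 := Measure.ae_ne volume 0
    filter_upwards [h0] with t ht
    refine propext ⟨fun h => ?_, fun h => ?_⟩
    · rcases lt_or_gt_of_ne ht with h' | h'
      · exact Or.inr ⟨h', h⟩
      · exact Or.inl ⟨h', h⟩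
    · rcases h with h | h
      · exact h.2
      · exact h.2
  have h3 := integral_add_compl hE hf
  rw [setIntegral_congr_set h2, setIntegral_union _ (measurableSet_Iio.diff hE)
    hf.integrableOn hf.integrableOn] at h3
  · rw [h1]
    linarith
  · rw [Set.disjoint_left]
    exact fun t ht ht' => lt_asymm (mem_Ioi.1 ht.1) (mem_Iio.1 ht'.1)

theorem gaussLine_real_eq {E : Set ℝ} :
    gaussLine.real E = (√(2 * Real.pi))⁻¹ * ∫ t in E, Real.exp (-t ^ 2 / 2) := by
  rw [gaussLine, measureReal_def, gaussianReal_apply_eq_integral 0 one_ne_zero,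
    ENNReal.toReal_ofReal (integral_nonneg fun x => gaussianPDFReal_nonneg 0 1 x),
    ← integral_const_mul]
  simp [gaussianPDFReal]

theorem gaussBarycenter_eq {E : Set ℝ} (hE : MeasurableSet E) :
    gaussBarycenter E = (√(2 * Real.pi))⁻¹ * ∫ t in E, t * Real.exp (-t ^ 2 / 2) := by
  rw [gaussBarycenter, ← integral_indicator hE, gaussLine,
    integral_gaussianReal_eq_integral_smul one_ne_zero, ← integral_const_mul,
    ← integral_indicator hE]
  refine integral_congr_ae (Eventually.of_forall fun t => ?_)
  by_cases ht : t ∈ E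
  · simp [ht, gaussianPDFReal]
    ring
  · simp [ht]

/-- First moment of the right half of the complement. -/
noncomputable def rightMoment (E : Set ℝ) : ℝ := ∫ t in Ioi 0 \ E, t * Real.exp (-t ^ 2 / 2)

/-- Mass of the right half of the complement. -/
noncomputable def rightMass (E : Set ℝ) : ℝ := ∫ t in Ioi 0 \ E, Real.exp (-t ^ 2 / 2)

theorem setIntegral_exp_eq {E : Set ℝ} (hE : MeasurableSet E) :
    ∫ t in E, Real.exp (-t ^ 2 / 2) =
      √(2 * Real.pi) - rightMass E - rightMass (Neg.neg ⁻¹' E) := by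
  rw [setIntegral_eq_sub_halves integrable_exp_neg_sq_half hE, integral_exp_neg_sq_half]
  simp [rightMass]

theorem setIntegral_mul_exp_eq {E : Set ℝ} (hE : MeasurableSet E) :
    ∫ t in E, t * Real.exp (-t ^ 2 / 2) = rightMoment (Neg.neg ⁻¹' E) - rightMoment E := by
  rw [setIntegral_eq_sub_halves integrable_mul_exp_neg_sq_half hE, integral_mul_exp_neg_sq_half]
  simp [rightMoment, integral_neg]
  ring

theorem Ioi_zero_sdiff_Iio {s : ℝ} (hs : 0 < s) : Ioi 0 \ Iio s = Ici s := by
  ext t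
  simp only [Set.mem_sdiff, mem_Ioi, mem_Iio, not_lt, mem_Ici]
  exact ⟨fun h => h.2, fun h => ⟨hs.trans_le h, h⟩⟩

theorem Ioi_zero_sdiff_neg_Iio {s : ℝ} (hs : 0 < s) : Ioi 0 \ (Neg.neg ⁻¹' Iio s) = ∅ := by
  ext t
  simp only [Set.mem_sdiff, mem_Ioi, mem_preimage, mem_Iio, not_lt, mem_empty_iff_false, iff_false,
    not_and, not_le]
  intro h
  linarith

theorem Ioi_zero_sdiff_Ioo {a : ℝ} (ha : 0 < a) : Ioi 0 \ Ioo (-a) a = Ici a := by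
  ext t
  simp only [Set.mem_sdiff, mem_Ioi, mem_Ioo, not_and, not_lt, mem_Ici]
  exact ⟨fun h => h.2 (by linarith [h.1]), fun h => ⟨ha.trans_le h, fun _ => h⟩⟩

theorem neg_preimage_Ioo (a : ℝ) : Neg.neg ⁻¹' Ioo (-a) a = Ioo (-a) a := by
  ext t
  simp only [mem_preimage, mem_Ioo]
  constructor <;> rintro ⟨h1, h2⟩ <;> constructor <;> linarith

theorem rightMass_Iio {s : ℝ} (hs : 0 < s) : rightMass (Iio s) = gaussTail s := by
  rw [rightMass, Ioi_zero_sdiff_Iio hs, integral_Ici_eq_integral_Ioi, gaussTail]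

theorem rightMass_neg_Iio {s : ℝ} (hs : 0 < s) : rightMass (Neg.neg ⁻¹' Iio s) = 0 := by
  rw [rightMass, Ioi_zero_sdiff_neg_Iio hs, setIntegral_empty]

theorem rightMass_Ioo {a : ℝ} (ha : 0 < a) : rightMass (Ioo (-a) a) = gaussTail a := by
  rw [rightMass, Ioi_zero_sdiff_Ioo ha, integral_Ici_eq_integral_Ioi, gaussTail]

theorem rightMoment_Iio {s : ℝ} (hs : 0 < s) : rightMoment (Iio s) = Real.exp (-s ^ 2 / 2) := by
  rw [rightMoment, Ioi_zero_sdiff_Iio hs, integral_Ici_eq_integral_Ioi,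
    integral_Ioi_mul_exp_neg_sq_half]

theorem rightMoment_neg_Iio {s : ℝ} (hs : 0 < s) : rightMoment (Neg.neg ⁻¹' Iio s) = 0 := by
  rw [rightMoment, Ioi_zero_sdiff_neg_Iio hs, setIntegral_empty]

theorem gaussTail_stripRadius {s : ℝ} (hs : 0 < s) :
    gaussTail (stripRadius s) = gaussTail s / 2 := by
  obtain ⟨ha, h⟩ := stripRadius_spec s
  rw [gaussLine_real_eq, gaussLine_real_eq, setIntegral_exp_eq measurableSet_Ioo,
    setIntegral_exp_eq measurableSet_Iio, rightMass_Iio hs, rightMass_neg_Iio hs,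
    neg_preimage_Ioo, rightMass_Ioo ha] at h
  have hpi : (√(2 * Real.pi))⁻¹ ≠ 0 := by positivity
  have := mul_left_cancel₀ hpi h
  linarith

/-- The whole line has barycenter 0, so up to sign only the complement's moments matter. The
constant is √(π/2) / (2π) = 1 / (2√(2π)). -/
theorem penalizedFunctional_eq {s : ℝ} (hs : 0 < s) (ε : ℝ) {E : Set ℝ} (hE : MeasurableSet E) :
    penalizedFunctional s ε E = gaussPerimeter E +
      ENNReal.ofReal (ε / (2 * √(2 * Real.pi)) *
        (rightMoment E - rightMoment (Neg.neg ⁻¹' E)) ^ 2) +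
      ENNReal.ofReal ((s + 1) *
        |rightMass E + rightMass (Neg.neg ⁻¹' E) - gaussTail s|) := by
  have hpi : 0 < √(2 * Real.pi) := by positivity
  have hsq : √(2 * Real.pi) ^ 2 = 2 * Real.pi := Real.sq_sqrt (by positivity)
  have hhalf : √(Real.pi / 2) = √(2 * Real.pi) / 2 := by
    rw [Real.sqrt_eq_iff_mul_self_eq (by positivity) (by positivity)]
    nlinarith
  rw [penalizedFunctional]
  congr 2
  · congr 1
    rw [sq_abs, gaussBarycenter_eq hE, setIntegral_mul_exp_eq hE, hhalf]
    generalize √(2 * Real.pi) = q at *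
    field_simp
    ring
  · rw [gaussPhi_eq, gaussLine_real_eq, gaussLine_real_eq, setIntegral_exp_eq hE,
      setIntegral_exp_eq measurableSet_Iio, rightMass_Iio hs, rightMass_neg_Iio hs, ← mul_sub,
      abs_mul, abs_of_pos (inv_pos.2 hpi), abs_sub_comm (rightMass E + _)]
    rw [show √(2 * Real.pi) - rightMass E - rightMass (Neg.neg ⁻¹' E) -
      (√(2 * Real.pi) - gaussTail s - 0) =
      gaussTail s - (rightMass E + rightMass (Neg.neg ⁻¹' E)) by ring]
    field_simp

theorem penalizedFunctional_Iio_le {s : ℝ} (hs : 0 < s) {ε : ℝ} (hε : 0 ≤ ε) :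
    penalizedFunctional s ε (Iio s) ≤ ENNReal.ofReal (Real.exp (-s ^ 2 / 2) +
      ε / (2 * √(2 * Real.pi)) * Real.exp (-s ^ 2 / 2) ^ 2) := by
  rw [penalizedFunctional_eq hs ε measurableSet_Iio, rightMass_Iio hs, rightMass_neg_Iio hs,
    rightMoment_Iio hs, rightMoment_neg_Iio hs, ENNReal.ofReal_add (by positivity) (by positivity)]
  have h := gaussPerimeter_le_sum (E := Iio s) measurableSet_Iio {s} fun x hx => by
    simpa using essBoundary_subset_frontier _ hx
  rw [Finset.sum_singleton] at h
  simpa using h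

theorem penalizedFunctional_strip_le {s : ℝ} (hs : 0 < s) (ε : ℝ) :
    penalizedFunctional s ε (Ioo (-stripRadius s) (stripRadius s)) ≤
      ENNReal.ofReal (2 * tailProfile (gaussTail s / 2)) := by
  have ha := (stripRadius_spec s).1
  rw [penalizedFunctional_eq hs ε measurableSet_Ioo, neg_preimage_Ioo, rightMass_Ioo ha,
    gaussTail_stripRadius hs, ← gaussTail_stripRadius hs, tailProfile_gaussTail ha,
    gaussTail_stripRadius hs]
  have h := gaussPerimeter_le_sum (E := Ioo (-stripRadius s) (stripRadius s)) measurableSet_Ioo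
    {-stripRadius s, stripRadius s} fun x hx => by
      have := essBoundary_subset_frontier _ hx
      rw [frontier_Ioo (by linarith)] at this
      simpa using this
  rw [Finset.sum_pair (by linarith : -stripRadius s < stripRadius s).ne, neg_sq, ← two_mul] at h
  simpa using h

theorem ae_eq_of_halves {E : Set ℝ} {m k : ℝ} (h1 : (Ioi 0 \ E : Set ℝ) =ᵐ[volume] halfTail m)
    (h2 : (Ioi 0 \ (Neg.neg ⁻¹' E) : Set ℝ) =ᵐ[volume] halfTail k) :
    E =ᵐ[volume] {x | x ∉ halfTail m ∧ -x ∉ halfTail k} := by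
  have h3 := (Measure.measurePreserving_neg (volume : Measure ℝ)).quasiMeasurePreserving.ae h2
  filter_upwards [h1, h3, Measure.ae_ne volume (0 : ℝ)] with t ht1 ht2 ht0
  have e1 : t ∈ Ioi 0 \ E ↔ t ∈ halfTail m := iff_of_eq ht1
  have e2 : -t ∈ Ioi 0 \ (Neg.neg ⁻¹' E) ↔ -t ∈ halfTail k := iff_of_eq ht2
  refine propext (show t ∈ E ↔ (t ∉ halfTail m ∧ -t ∉ halfTail k) from ?_)
  rw [← e1, ← e2]
  simp only [Set.mem_sdiff, mem_Ioi, mem_preimage, neg_neg, not_and, not_not]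
  constructor
  · exact fun h => ⟨fun _ => h, fun _ => h⟩
  · rintro ⟨h, h'⟩
    rcases lt_or_gt_of_ne ht0 with hneg | hpos
    · exact h' (by linarith)
    · exact h hpos

theorem finite_essBoundary_neg {E : Set ℝ} (hfin : ∀ a b, (essBoundary E ∩ Icc a b).Finite)
    (a b : ℝ) : (essBoundary (Neg.neg ⁻¹' E) ∩ Icc a b).Finite := by
  refine ((hfin (-b) (-a)).preimage (f := Neg.neg) neg_injective.injOn).subset ?_
  rintro x ⟨hx, hxI⟩
  exact ⟨essBoundary_preimage_neg E hx, by linarith [hxI.2], by linarith [hxI.1]⟩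

/-! ### Rigidity and the theorem -/

theorem minTailEnergy_le_mul {β s : ℝ} (hβs : β * Real.exp (-s ^ 2 / 2) ≤ 7 / 10 / s ^ 2) :
    minTailEnergy β s ≤ (1 + 7 / 10 / s ^ 2) * Real.exp (-s ^ 2 / 2) := by
  refine (min_le_left _ _).trans ?_
  have := mul_le_mul_of_nonneg_right hβs (Real.exp_pos (-s ^ 2 / 2)).le
  nlinarith

/-- Moving from s to s - 1 multiplies the Gaussian weight by e^(s - 1/2), far above the factor 1 + 7
/ (10 s²). Hence sets of energy at most V have no boundary point in (-(s-1), s-1). -/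
theorem minTailEnergy_lt {β s : ℝ} (hs : 100 ≤ s)
    (hβs : β * Real.exp (-s ^ 2 / 2) ≤ 7 / 10 / s ^ 2) :
    minTailEnergy β s < Real.exp (-(s - 1) ^ 2 / 2) := by
  refine (minTailEnergy_le_mul hβs).trans_lt ?_
  have h1 : Real.exp (-(s - 1) ^ 2 / 2) = Real.exp (s - 1 / 2) * Real.exp (-s ^ 2 / 2) := by
    rw [← Real.exp_add]
    ring_nf
  rw [h1]
  apply mul_lt_mul_of_pos_right _ (Real.exp_pos _)
  have h2 := Real.add_one_le_exp (s - 1 / 2)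
  have h3 : 7 / 10 / s ^ 2 ≤ 7 / 10 := div_le_self (by norm_num) (by nlinarith)
  linarith

/-- A set which is empty near the origin misses too much mass. -/
theorem lt_penalty_of_null {β s : ℝ} (hs : 100 ≤ s)
    (hβs : β * Real.exp (-s ^ 2 / 2) ≤ 7 / 10 / s ^ 2) {E : Set ℝ}
    (hnull : volume (Ioo (-(s - 1)) (s - 1) ∩ E) = 0) :
    minTailEnergy β s <
      (s + 1) * |rightMass E + rightMass (Neg.neg ⁻¹' E) - gaussTail s| := by
  have hmass : ∀ F : Set ℝ, volume (Ioo (-(s - 1)) (s - 1) ∩ F) = 0 →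
      gaussTail 0 - gaussTail (s - 1) ≤ rightMass F := by
    intro F hF
    have h0 : gaussTail 0 - gaussTail (s - 1) =
        ∫ t in Ioi 0 \ Ioi (s - 1), Real.exp (-t ^ 2 / 2) := by
      rw [setIntegral_sdiff measurableSet_Ioi integrable_exp_neg_sq_half.integrableOn
        (Ioi_subset_Ioi (by linarith)), gaussTail, gaussTail]
    rw [h0, rightMass]
    refine setIntegral_mono_set integrable_exp_neg_sq_half.integrableOn
      (Eventually.of_forall fun t => (Real.exp_pos _).le) (ae_le_set.2 ?_)
    refine measure_mono_null ?_ (measure_union_null hF (measure_singleton (s - 1)))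
    rintro t ⟨⟨ht0, ht⟩, htF⟩
    have ht0' := mem_Ioi.1 ht0
    rcases (not_lt.1 (mem_Ioi.not.1 ht)).eq_or_lt with h | h
    · exact Or.inr h
    · refine Or.inl ⟨⟨by linarith, h⟩, ?_⟩
      by_contra h'
      exact htF ⟨ht0, h'⟩
  have hnull' : volume (Ioo (-(s - 1)) (s - 1) ∩ (Neg.neg ⁻¹' E)) = 0 := by
    rw [← neg_preimage_Ioo, ← preimage_inter, Measure.measure_preimage_neg]
    exact hnull
  have h1 := hmass E hnull
  have h2 := hmass _ hnull'
  have h3 : gaussTail s ≤ gaussTail (s - 1) := strictAnti_gaussTail.antitone (by linarith)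
  have hx0 : 0 < s - 1 := by linarith
  have hle1 : ∀ x : ℝ, Real.exp (-x ^ 2 / 2) ≤ 1 := fun x =>
    Real.exp_le_one_iff.2 (by nlinarith [sq_nonneg x])
  have h4 : gaussTail (s - 1) ≤ 1 / 99 := (gaussTail_le hx0).trans (by
    gcongr
    · exact hle1 _
    · linarith)
  have h5 : 1 / 4 ≤ gaussTail 0 := by
    have h6 := le_gaussTail 1
    have h7 : gaussTail 1 < gaussTail 0 := strictAnti_gaussTail one_pos
    have h8 := Real.add_one_le_exp (-(1 : ℝ) ^ 2 / 2)
    norm_num at h6 h8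
    linarith
  have h9 := minTailEnergy_lt hs hβs
  have h10 := hle1 (s - 1)
  -- Missing mass at least 2 (1/4 - 1/99) against T(s) ≤ 1/99. Multiplied by s + 1 this exceeds 1,
  -- while V < 1.
  have h11 : (1 : ℝ) / 10 ≤ |rightMass E + rightMass (Neg.neg ⁻¹' E) - gaussTail s| :=
    le_trans (by linarith) (le_abs_self _)
  nlinarith

/-- Stated only for energies at most V: this confines the boundary, and the conclusion V ≤ energy
then forces equality, from which the shape is read off. -/
theorem penalizedFunctional_rigidity {s ε : ℝ} (hs : 100 ≤ s) (hε : 0 ≤ ε)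
    (hβs : ε / (2 * √(2 * Real.pi)) * Real.exp (-s ^ 2 / 2) ≤ 7 / 10 / s ^ 2) {E : Set ℝ}
    (hE : HasLocallyFinitePerimeter E)
    (hle : penalizedFunctional s ε E ≤
      ENNReal.ofReal (minTailEnergy (ε / (2 * √(2 * Real.pi))) s)) :
    ENNReal.ofReal (minTailEnergy (ε / (2 * √(2 * Real.pi))) s) ≤ penalizedFunctional s ε E ∧
      (E =ᵐ[volume] Iio s ∨ E =ᵐ[volume] Ioi (-s) ∨
        E =ᵐ[volume] Ioo (-stripRadius s) (stripRadius s)) := by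
  have hs0 : 0 < s := by linarith
  rw [penalizedFunctional_eq hs0 ε hE.1] at hle ⊢
  set β := ε / (2 * √(2 * Real.pi)) with hβdef
  have hβ : 0 ≤ β := by positivity
  set bary := β * (rightMoment E - rightMoment (Neg.neg ⁻¹' E)) ^ 2 with hbary
  set pen := (s + 1) * |rightMass E + rightMass (Neg.neg ⁻¹' E) - gaussTail s| with hpen
  have hbary0 : 0 ≤ bary := by positivity
  have hpen0 : 0 ≤ pen := by positivity
  have hV0 : 0 ≤ minTailEnergy β s :=
    le_min (by positivity) (mul_nonneg two_pos.le (tailProfile_nonneg _))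
  have hlow : ∀ A : Finset ℝ, (∀ x ∈ A, x ∈ essBoundary E) →
      ENNReal.ofReal (∑ x ∈ A, Real.exp (-x ^ 2 / 2) + bary + pen) ≤
        gaussPerimeter E + ENNReal.ofReal bary + ENNReal.ofReal pen := by
    intro A hA
    have h0 : 0 ≤ ∑ x ∈ A, Real.exp (-x ^ 2 / 2) := Finset.sum_nonneg fun x _ => (Real.exp_pos _).le
    rw [ENNReal.ofReal_add (by positivity) hpen0, ENNReal.ofReal_add h0 hbary0]
    gcongr
    exact sum_le_gaussPerimeter hE A hA
  have hup : ∀ A : Finset ℝ, (∀ x ∈ A, x ∈ essBoundary E) →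
      ∑ x ∈ A, Real.exp (-x ^ 2 / 2) + bary + pen ≤ minTailEnergy β s := fun A hA =>
    (ENNReal.ofReal_le_ofReal_iff hV0).1 ((hlow A hA).trans hle)
  have hx₀ : 0 < s - 1 := by linarith
  have hfar : ∀ x ∈ Ioo (-(s - 1)) (s - 1), x ∉ essBoundary E := by
    intro x hx hxE
    have h1 := hup {x} (by simpa using hxE)
    rw [Finset.sum_singleton] at h1
    have h2 := minTailEnergy_lt hs hβs
    have h3 : Real.exp (-(s - 1) ^ 2 / 2) ≤ Real.exp (-x ^ 2 / 2) := by
      rw [← sq_abs x, exp_neg_sq_half_le_iff hx₀.le (abs_nonneg x)]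
      exact (abs_lt.2 hx).le
    linarith
  rcases null_or_conull_of_disjoint_essBoundary isPreconnected_Ioo hfar with hnull | hfull
  · have h1 := lt_penalty_of_null hs hβs hnull
    have h2 := hup ∅ (by simp)
    rw [Finset.sum_empty] at h2
    linarith
  have hfull' : volume (Ioo (-(s - 1)) (s - 1) \ (Neg.neg ⁻¹' E)) = 0 := by
    rw [← neg_preimage_Ioo, ← preimage_sdiff, Measure.measure_preimage_neg]
    exact hfull
  obtain ⟨μ, σ, hGG⟩ := hE.2
  have hfin := hGG.finite_essBoundary_inter hE.1
  obtain ⟨A, m, d, hA, hm0, hm1, hd0, hmu, hAm, hmass, hmeq⟩ :=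
    exists_right_halfTail hE.1 hfin hx₀ hfull
  -- The left side is the right side of the reflected set.
  obtain ⟨B, k, e, hB, hk0, hk1, he0, hku, hBk, hkass, hkeq⟩ :=
    exists_right_halfTail (measurable_neg hE.1) (finite_essBoundary_neg hfin) hx₀ hfull'
  have hdisj : Disjoint A (B.image Neg.neg) := by
    rw [Finset.disjoint_left]
    intro x hx hx'
    obtain ⟨y, hy, rfl⟩ := Finset.mem_image.1 hx'
    linarith [(hA _ hx).1, (hB _ hy).1]
  have hAB : ∀ x ∈ A ∪ B.image Neg.neg, x ∈ essBoundary E := by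
    intro x hx
    rcases Finset.mem_union.1 hx with hx | hx
    · exact (hA x hx).2
    · obtain ⟨y, hy, rfl⟩ := Finset.mem_image.1 hx
      exact essBoundary_preimage_neg E (hB y hy).2
  have hsum : ∑ x ∈ A ∪ B.image Neg.neg, Real.exp (-x ^ 2 / 2) =
      ∑ x ∈ A, Real.exp (-x ^ 2 / 2) + ∑ x ∈ B, Real.exp (-x ^ 2 / 2) := by
    rw [Finset.sum_union hdisj, Finset.sum_image neg_injective.injOn]
    simp
  have hlow' := hlow _ hAB
  have hup' := hup _ hAB
  rw [hsum] at hlow' hup'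
  have hbary' : bary = β * (tailProfile m - tailProfile k) ^ 2 := by
    rw [hbary, rightMoment, rightMoment, hmu, hku]
  -- The mass error is at most (d + e) / (s - 1), and (s + 1) / (s - 1) ≤ 3/2 for s ≥ 100. The
  -- perimeter surplus 2(d + e) absorbs it with (d + e)/2 to spare.
  have hpen' : (s + 1) * |m + k - gaussTail s| - 3 / 2 * (d + e) ≤ pen := by
    have h1 : |m + k - gaussTail s| - (d + e) / (s - 1) ≤
        |rightMass E + rightMass (Neg.neg ⁻¹' E) - gaussTail s| := by
      have h2 : |m + k - gaussTail s| ≤ |rightMass E + rightMass (Neg.neg ⁻¹' E) - gaussTail s| +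
          |rightMass E - m| + |rightMass (Neg.neg ⁻¹' E) - k| := by
        have := abs_sub_le (m + k - gaussTail s)
          (rightMass E + rightMass (Neg.neg ⁻¹' E) - gaussTail s) 0
        rw [sub_zero, sub_zero] at this
        have h3 : |m + k - gaussTail s - (rightMass E + rightMass (Neg.neg ⁻¹' E) - gaussTail s)| ≤
            |rightMass E - m| + |rightMass (Neg.neg ⁻¹' E) - k| := by
          rw [abs_sub_comm]
          refine le_trans (le_of_eq ?_) (abs_add_le _ _)
          congr 1
          ring
        linarith
      rw [add_div]
      have h4 : |rightMass E - m| ≤ d / (s - 1) := hmass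
      have h5 : |rightMass (Neg.neg ⁻¹' E) - k| ≤ e / (s - 1) := hkass
      linarith
    have h6 : (s + 1) * ((d + e) / (s - 1)) ≤ 3 / 2 * (d + e) := by
      rw [← mul_div_assoc, div_le_iff₀ hx₀]
      nlinarith
    have h7 := mul_le_mul_of_nonneg_left h1 (by linarith : 0 ≤ s + 1)
    rw [mul_sub] at h7
    linarith
  have htail : gaussTail (s - 1) < gaussTail 0 := strictAnti_gaussTail hx₀
  have hmin := minTailEnergy_le hs hβ hβs hk0 hm0 (hk1.trans_lt htail) (hm1.trans_lt htail)
  have hcases := penalizedTailEnergy_cases hs hβ hβs hk0 hm0 (hk1.trans_lt htail)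
    (hm1.trans_lt htail)
  rw [penalizedTailEnergy] at hmin hcases
  refine ⟨(ENNReal.ofReal_le_ofReal ?_).trans hlow', ?_⟩
  · linarith
  -- The spare (d + e)/2 must vanish, since the energy is at most V and the two-half-line energy at
  -- least V.
  have hd : d = 0 := by linarith
  have he : e = 0 := by linarith
  have hEeq := ae_eq_of_halves (hmeq hd) (hkeq he)
  rcases hcases with h | ⟨rfl, rfl⟩ | ⟨rfl, rfl⟩ | ⟨rfl, rfl⟩
  · linarith
  · left
    refine hEeq.trans (EventuallyEq.trans (Eventually.of_forall fun x => ?_) Iio_ae_eq_Iic.symm)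
    rw [halfTail_zero, halfTail_gaussTail hs0.le]
    refine propext (show (x ∉ Ioi s ∧ -x ∉ (∅ : Set ℝ)) ↔ x ∈ Iic s from ?_)
    simp
  · right; left
    refine hEeq.trans (EventuallyEq.trans (Eventually.of_forall fun x => ?_) Ioi_ae_eq_Ici.symm)
    rw [halfTail_zero, halfTail_gaussTail hs0.le]
    refine propext (show (x ∉ (∅ : Set ℝ) ∧ -x ∉ Ioi s) ↔ x ∈ Ici (-s) from ?_)
    simp only [mem_empty_iff_false, not_false_eq_true, true_and, mem_Ioi, not_lt, mem_Ici]
    exact neg_le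
  · right; right
    refine hEeq.trans (EventuallyEq.trans (Eventually.of_forall fun x => ?_) Ioo_ae_eq_Icc.symm)
    rw [← gaussTail_stripRadius hs0, halfTail_gaussTail (stripRadius_spec s).1.le]
    refine propext (show (x ∉ Ioi (stripRadius s) ∧ -x ∉ Ioi (stripRadius s)) ↔
      x ∈ Icc (-stripRadius s) (stripRadius s) from ?_)
    simp only [mem_Ioi, not_lt, mem_Icc]
    rw [and_comm, neg_le]

theorem exists_penalizedFunctional_le {s ε : ℝ} (hs : 0 < s) (hε : 0 ≤ ε) :
    ∃ E, HasLocallyFinitePerimeter E ∧ penalizedFunctional s ε E ≤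
      ENNReal.ofReal (minTailEnergy (ε / (2 * √(2 * Real.pi))) s) := by
  rw [minTailEnergy]
  rcases min_choice (Real.exp (-s ^ 2 / 2) + ε / (2 * √(2 * Real.pi)) *
    Real.exp (-s ^ 2 / 2) ^ 2) (2 * tailProfile (gaussTail s / 2)) with h | h
  · rw [h]
    exact ⟨_, hasLocallyFinitePerimeter_Iio s, penalizedFunctional_Iio_le hs hε⟩
  · rw [h]
    exact ⟨_, hasLocallyFinitePerimeter_Ioo (stripRadius_spec s).1,
      penalizedFunctional_strip_le hs ε⟩

theorem mainTheorem6 :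
    ∃ s₀ : ℝ, 0 < s₀ ∧ ∀ s : ℝ, s₀ ≤ s → ∀ ε : ℝ,
      6 / 5 * (√(2 * Real.pi) / s ^ 2) * Real.exp (s ^ 2 / 2) ≤ ε →
      ε ≤ 7 / 5 * (√(2 * Real.pi) / s ^ 2) * Real.exp (s ^ 2 / 2) →
      (∃ E : Set ℝ, IsPenalizedMinimizer s ε E) ∧
      ∀ E : Set ℝ, IsPenalizedMinimizer s ε E →
        (E =ᵐ[volume] Iio s ∨ E =ᵐ[volume] Ioi (-s) ∨
          E =ᵐ[volume] Ioo (-stripRadius s) (stripRadius s)) := by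
  refine ⟨100, by norm_num, fun s hs ε hε1 hε2 => ?_⟩
  have hs0 : 0 < s := by linarith
  have hε : 0 ≤ ε := le_trans (by positivity) hε1
  have hβs : ε / (2 * √(2 * Real.pi)) * Real.exp (-s ^ 2 / 2) ≤ 7 / 10 / s ^ 2 := by
    have hpi : 0 < √(2 * Real.pi) := by positivity
    have hexp : Real.exp (s ^ 2 / 2) * Real.exp (-s ^ 2 / 2) = 1 := by
      rw [← Real.exp_add]
      ring_nf
      exact Real.exp_zero
    calc ε / (2 * √(2 * Real.pi)) * Real.exp (-s ^ 2 / 2)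
        ≤ 7 / 5 * (√(2 * Real.pi) / s ^ 2) * Real.exp (s ^ 2 / 2) / (2 * √(2 * Real.pi)) *
          Real.exp (-s ^ 2 / 2) := by gcongr
      _ = 7 / 10 / s ^ 2 * (Real.exp (s ^ 2 / 2) * Real.exp (-s ^ 2 / 2)) := by
        field_simp
        norm_num
      _ = 7 / 10 / s ^ 2 := by rw [hexp, mul_one]
  obtain ⟨E₀, hE₀, hE₀le⟩ := exists_penalizedFunctional_le hs0 hε
  refine ⟨⟨E₀, hE₀, fun F hF => hE₀le.trans ?_⟩, fun E hE => ?_⟩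
  -- A competitor above V needs no argument; below V, rigidity shows it equals V.
  · rcases le_total (penalizedFunctional s ε F)
      (ENNReal.ofReal (minTailEnergy (ε / (2 * √(2 * Real.pi))) s)) with h | h
    · exact (penalizedFunctional_rigidity hs hε hβs hF h).1
    · exact h
  · exact (penalizedFunctional_rigidity hs hε hβs hE.1 ((hE.2 E₀ hE₀).trans hE₀le)).2
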